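/- **Theorem (PIT for set-multilinear ABPs).** Let $\mathbb{F}$ be a field, let $D,n,r$ be natural numbers with $D\ge 1$, and let $X=\bigsqcup_{0\le i<D}X_i$ with $X_i=\{x_{i,j}\}_{0\le j<n}$ be a (known) partition of the variables. A *set-multilinear algebraic branching program (ABP)* of depth $D$ is a directed acyclic graph with vertices on levels $0,\dots,D$ and edges only from a level $i$ to level $i+1$, each labelled by a homogeneous linear form in $X_i$; the only vertex on level $0$ is the source, which is the only vertex of in-degree zero, and the only vertex on level $D$ is the sink, which is the only vertex of out-degree zero. Its width is the largest number of vertices on a level, and it computes the (set-multilinear) polynomial $\sum_{\text{source-sink paths}}\ \prod(\text{labels on the path})\in\mathbb{F}[X]$. Let $\mathcal{C}$ be the set of polynomials computed by set-multilinear ABPs of depth $D$ and width at most $r$. If $|\mathbb{F}|\ge(2Dnr^3)^2$, then $\mathcal{C}$ has a $\mathrm{poly}(D,n,r)$-explicit hitting set $\mathcal{H}\subseteq\mathbb{F}^{nD}$ of size at most $(2Dn^2r^4)^{\lceil\lg D\rceil+1}$. Here $\lg=\log_2$. That $\mathcal{H}$ is a hitting set means that every $f\in\mathcal{C}$ is the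 zero polynomial if and only if $f$ vanishes at all points of $\mathcal{H}$. Explicitness means the following. There are one random access program $P$ and one polynomial $p$ with natural number coefficients, both independent of $\mathbb{F},D,n,r$, such that for every such $\mathbb{F},D,n,r$ and every enumeration $e$ of $\mathbb{F}$ (a sequence $e_0,e_1,\dots$ in $\mathbb{F}$ whose terms $e_a$ with $a<|\mathbb{F}|$ are pairwise distinct), there is such a hitting set $\mathcal{H}=\{h_0,\dots,h_{N-1}\}$ (repetitions allowed) with $N\le(2Dn^2r^4)^{\lceil\lg D\rceil+1}$, and for every $k<N$ the program $P$ on input $(D,n,r,k)$ outputs all coordinates of $h_k$ within $p(D,n,r)$ steps. The program can name only the field elements $0$, $1$ and $e_a$ (for a computed $a$); each arithmetic operation, equality test and enumeration query in $\mathbb{F}$ counts as one step, and operations on natural numbers (including the index, and addresses of memory cells) are charged additionally for the bit lengths of the numbers involved. -/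

import Mathlib

noncomputable section

namespace PIT

/-! # Set-multilinear algebraic branching programs -/

/-- A set-multilinear algebraic branching program of depth `D` over the field `F`, in the variables
`x_{i,j}` with `i ∈ {0, …, D-1}` and `j ∈ {0, …, n-1}`; the `i`-th block of variables is
`X_i = {x_{i,0}, …, x_{i,n-1}}`.  It is a directed acyclic graph whose vertices lie on the levels
`0, …, D`.  Edges go from level `i` to level `i + 1` only, and are labelled with homogeneous linear
forms in the block `X_i`.  Level `0` consists of the source and level `D` of the sink. -/
structure SetMultilinearABP (F : Type*) [Field F] (D n : ℕ) where
  /-- the number of vertices on each level -/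
  size : Fin (D + 1) → ℕ
  /-- the source is the only vertex on level `0` -/
  size_zero : size 0 = 1
  /-- the sink is the only vertex on level `D` -/
  size_last : size (Fin.last D) = 1
  /-- the edges from level `i` to level `i + 1` -/
  Adj : ∀ i : Fin D, Fin (size i.castSucc) → Fin (size i.succ) → Prop
  /-- only the source has in-degree zero -/
  exists_in : ∀ (i : Fin D) (v : Fin (size i.succ)), ∃ u, Adj i u v
  /-- only the sink has out-degree zero -/
  exists_out : ∀ (i : Fin D) (u : Fin (size i.castSucc)), ∃ v, Adj i u v
  /-- the coefficients of the linear form `∑ j, label i u v j * x_{i,j}` on the edge `u → v` -/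
  label : ∀ i : Fin D, Fin (size i.castSucc) → Fin (size i.succ) → Fin n → F

namespace SetMultilinearABP

variable {F : Type*} [Field F] {D n : ℕ}

/-- The width of a branching program: the largest number of vertices on a level. -/
def width (A : SetMultilinearABP F D n) : ℕ :=
  Finset.univ.sup A.size

/-- The linear form on the edge `u → v`. -/
def linearForm (A : SetMultilinearABP F D n) (i : Fin D) (u : Fin (A.size i.castSucc))
    (v : Fin (A.size i.succ)) : MvPolynomial (Fin D × Fin n) F :=
  ∑ j : Fin n, MvPolynomial.C (A.label i u v j) * MvPolynomial.X (i, j)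

/-- A choice of one vertex on each level is a source-sink path if consecutive vertices are
joined by edges. -/
def IsPath (A : SetMultilinearABP F D n) (p : ∀ k : Fin (D + 1), Fin (A.size k)) : Prop :=
  ∀ i : Fin D, A.Adj i (p i.castSucc) (p i.succ)

open Classical in
/-- The polynomial computed by a branching program: the sum, over all source-sink paths, of the
product of the labels on the path. -/
def toPoly (A : SetMultilinearABP F D n) : MvPolynomial (Fin D × Fin n) F :=
  ∑ p : (∀ k : Fin (D + 1), Fin (A.size k)) with A.IsPath p,
    ∏ i : Fin D, A.linearForm i (p i.castSucc) (p i.succ)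

end SetMultilinearABP

/-- The (set-multilinear) polynomials computed by a set-multilinear branching program of depth `D`
and width at most `r`, for the variable partition into the blocks `{i} × {0, …, n-1}`. -/
def setMultilinearABPClass (F : Type*) [Field F] (D n r : ℕ) :
    Set (MvPolynomial (Fin D × Fin n) F) :=
  {f | ∃ A : SetMultilinearABP F D n, A.width ≤ r ∧ A.toPoly = f}

/-- `H` is a hitting set for the class `𝒞`: a member of `𝒞` is the zero polynomial if and only if
it vanishes at every point of `H`. -/
def IsHittingSet {σ F : Type*} [Field F] (𝒞 : Set (MvPolynomial σ F)) (H : Set (σ → F)) : Prop :=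
  ∀ f ∈ 𝒞, f = 0 ↔ ∀ x ∈ H, MvPolynomial.eval x f = 0

/-! # Random access programs over a field

The memory has cells for natural numbers and cells for field elements, both addressed by natural
numbers.  Every arithmetic operation, equality test and enumeration query in the field costs one
step; operations on natural numbers are charged in addition for the bit lengths of the numbers
involved.  The programs do not mention the field: the only field elements they can name are `0`,
`1` and, as `elem k`, the `k`-th element of a given enumeration of the field. -/

/-- The memory of a random access program. -/
structure Memory (F : Type*) where
  /-- the cells that hold natural numbers -/
  nat : ℕ → ℕ
  /-- the cells that hold field elements -/
  fld : ℕ → F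

/-- Expressions for natural numbers; `read a` is the content of the cell with address `a`. -/
inductive NatExpr : Type
  | const (c : ℕ)
  | read (a : NatExpr)
  | add (a b : NatExpr)
  | sub (a b : NatExpr)
  | mul (a b : NatExpr)
  | div (a b : NatExpr)
  | mod (a b : NatExpr)

/-- Expressions for field elements; `read a` is the content of the cell with address `a`, and
`elem a` is the element with number `a` in the enumeration of the field. -/
inductive FldExpr : Type
  | zero
  | one
  | elem (a : NatExpr)
  | read (a : NatExpr)
  | add (x y : FldExpr)
  | sub (x y : FldExpr)
  | mul (x y : FldExpr)
  | div (x y : FldExpr)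

/-- Tests. -/
inductive Test : Type
  | natLt (a b : NatExpr)
  | natEq (a b : NatExpr)
  | fldEq (x y : FldExpr)

/-- Programs. -/
inductive Program : Type
  | skip
  | setNat (a b : NatExpr)
  | setFld (a : NatExpr) (x : FldExpr)
  | seq (P Q : Program)
  | branch (b : Test) (P Q : Program)
  | loop (b : Test) (P : Program)

namespace NatExpr

/-- The value of an expression, for the natural number cells `m`. -/
def val (m : ℕ → ℕ) : NatExpr → ℕ
  | const c => c
  | read a => m (a.val m)
  | add a b => a.val m + b.val m
  | sub a b => a.val m - b.val m
  | mul a b => a.val m * b.val m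
  | div a b => a.val m / b.val m
  | mod a b => a.val m % b.val m

/-- The cost of evaluating an expression: one step per operation, plus the bit lengths of the
numbers involved. -/
def cost (m : ℕ → ℕ) : NatExpr → ℕ
  | const c => 1 + c.size
  | read a => a.cost m + (1 + (a.val m).size + (m (a.val m)).size)
  | add a b => a.cost m + b.cost m + (1 + (a.val m).size + (b.val m).size)
  | sub a b => a.cost m + b.cost m + (1 + (a.val m).size + (b.val m).size)
  | mul a b => a.cost m + b.cost m + (1 + (a.val m).size + (b.val m).size)
  | div a b => a.cost m + b.cost m + (1 + (a.val m).size + (b.val m).size)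
  | mod a b => a.cost m + b.cost m + (1 + (a.val m).size + (b.val m).size)

end NatExpr

namespace FldExpr

/-- The value of an expression, for the enumeration `e` and the memory `s`. -/
def val {F : Type*} [Field F] (e : ℕ → F) (s : Memory F) : FldExpr → F
  | zero => 0
  | one => 1
  | elem a => e (a.val s.nat)
  | read a => s.fld (a.val s.nat)
  | add x y => x.val e s + y.val e s
  | sub x y => x.val e s - y.val e s
  | mul x y => x.val e s * y.val e s
  | div x y => x.val e s / y.val e s

/-- The cost of evaluating an expression: one step per operation, plus the cost of the expressions
for natural numbers that occur in it. -/
def cost (m : ℕ → ℕ) : FldExpr → ℕ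
  | zero => 1
  | one => 1
  | elem a => a.cost m + 1
  | read a => a.cost m + 1
  | add x y => x.cost m + y.cost m + 1
  | sub x y => x.cost m + y.cost m + 1
  | mul x y => x.cost m + y.cost m + 1
  | div x y => x.cost m + y.cost m + 1

end FldExpr

namespace Test

/-- The outcome of a test. -/
def Holds {F : Type*} [Field F] (e : ℕ → F) (s : Memory F) : Test → Prop
  | natLt a b => a.val s.nat < b.val s.nat
  | natEq a b => a.val s.nat = b.val s.nat
  | fldEq x y => x.val e s = y.val e s

/-- The cost of a test. -/
def cost (m : ℕ → ℕ) : Test → ℕ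
  | natLt a b => a.cost m + b.cost m + 1
  | natEq a b => a.cost m + b.cost m + 1
  | fldEq x y => x.cost m + y.cost m + 1

end Test

/-- `Runs e P s s' t`: the program `P`, started with memory `s`, halts after `t` steps with
memory `s'`. -/
inductive Runs {F : Type*} [Field F] (e : ℕ → F) : Program → Memory F → Memory F → ℕ → Prop
  | skip (s : Memory F) : Runs e Program.skip s s 1
  | setNat (a b : NatExpr) (s : Memory F) :
      Runs e (Program.setNat a b) s
        { nat := Function.update s.nat (a.val s.nat) (b.val s.nat), fld := s.fld }
        (a.cost s.nat + b.cost s.nat + 1)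
  | setFld (a : NatExpr) (x : FldExpr) (s : Memory F) :
      Runs e (Program.setFld a x) s
        { nat := s.nat, fld := Function.update s.fld (a.val s.nat) (x.val e s) }
        (a.cost s.nat + x.cost s.nat + 1)
  | seq {P Q : Program} {s s' s'' : Memory F} {t t' : ℕ}
      (hP : Runs e P s s' t) (hQ : Runs e Q s' s'' t') :
      Runs e (Program.seq P Q) s s'' (t + t')
  | branch_true {b : Test} {P Q : Program} {s s' : Memory F} {t : ℕ}
      (hb : b.Holds e s) (hP : Runs e P s s' t) :
      Runs e (Program.branch b P Q) s s' (b.cost s.nat + 1 + t)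
  | branch_false {b : Test} {P Q : Program} {s s' : Memory F} {t : ℕ}
      (hb : ¬ b.Holds e s) (hQ : Runs e Q s s' t) :
      Runs e (Program.branch b P Q) s s' (b.cost s.nat + 1 + t)
  | loop_stop {b : Test} {P : Program} {s : Memory F} (hb : ¬ b.Holds e s) :
      Runs e (Program.loop b P) s s (b.cost s.nat + 1)
  | loop_step {b : Test} {P : Program} {s s' s'' : Memory F} {t t' : ℕ}
      (hb : b.Holds e s) (hP : Runs e P s s' t) (hL : Runs e (Program.loop b P) s' s'' t') :
      Runs e (Program.loop b P) s s'' (b.cost s.nat + 1 + t + t')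

/-- The initial memory: the natural number cells `0, 1, 2, 3` hold the parameters `D, n, r` and the
index `k`, and all other cells hold `0`. -/
def inputMemory (F : Type*) [Field F] (D n r k : ℕ) : Memory F where
  nat := fun a => [D, n, r, k].getD a 0
  fld := fun _ => 0

/-- With the input `D, n, r, k`, the program `P` halts within `T` steps, and the coordinate
`x (i, j)` of the point `x` is then found in the field cell with address `n * i + j`. -/
def ComputesPoint {F : Type*} [Field F] (e : ℕ → F) (P : Program) (D n r k : ℕ)
    (x : Fin D × Fin n → F) (T : ℕ) : Prop :=
  ∃ (s : Memory F) (t : ℕ), Runs e P (inputMemory F D n r k) s t ∧ t ≤ T ∧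
    ∀ (i : Fin D) (j : Fin n), s.fld (n * i + j) = x (i, j)

/-- `e` lists elements of `F` without repetition: if `F` is finite, the first `|F|` values are
all elements of `F`, each listed once; if `F` is infinite, all values are distinct. -/
def IsFieldEnumeration {F : Type*} (e : ℕ → F) : Prop :=
  ∀ a b : ℕ, (a : Cardinal) < Cardinal.mk F → (b : Cardinal) < Cardinal.mk F → e a = e b → a = b

end PIT

end

noncomputable section

namespace PIT

open Polynomial

/-! Padding with zeros to r × r matrices turns the polynomial of a branching program into the entry
(0, 0) of a product of D matrices, the i-th one linear in X_i (`SetMultilinearABP.aeval_toPoly`).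
Multiply these matrices along a binary tree and put s = n r². On each level of the tree, s
substitutions common to all nodes of that level suffice for the values of every node to span all
matrices the node can produce. On the leaves the unit vectors do this. If it holds for two siblings,
the s² pairwise products span all values of the parent. A Lagrange curve passes through the s²
combined substitutions, and along it the parent is a matrix polynomial of degree at most D(s² - 1).
Matrices form a space of dimension r² ≤ s, so by the condenser `finite_setOf_not_mem_span_values`
the curve points at α, gα, …, g^(s-1) α already span all its values, for all but finitely many α,
provided that the powers of g with exponent below D s² are distinct. Thus one seed α per level
brings s² substitutions back to s (`exists_seeds_span`).

At the root a nonzero polynomial is nonzero at one of the s points, and the power of g that selects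
this point is absorbed into the last seed. The value has degree at most D(s² - 1) in each seed, so
the seeds can be moved one at a time into the first B = 2 D s² enumerated field elements
(`exists_seeds_ne_zero`). The base-B digits of the index k list the seeds.

For explicitness, a coordinate of a point depends only on the same coordinate of the points one
level below, so a table of s field elements is updated level by level. The element g is found by
trial (`IsFieldEnumeration.exists_hasLargeOrder`). Time bounds come from the syntax alone: `Exec`
builds in the bound `weight * (β + 1) ^ rank`, and what remains is to verify loop invariants. -/

/-! ### The rank condenser. -/

theorem coeff_prod_sum_of_natDegree_le {R ι : Type*} [CommRing R] (t : Finset ι) (f : ι → R[X])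
    (b : ι → ℕ) (h : ∀ i ∈ t, (f i).natDegree ≤ b i) :
    (∏ i ∈ t, f i).coeff (∑ i ∈ t, b i) = ∏ i ∈ t, (f i).coeff (b i) := by
  classical
  induction t using Finset.induction_on with
  | empty => simp
  | insert a t ha ih =>
    rw [Finset.prod_insert ha, Finset.sum_insert ha, Finset.prod_insert ha,
      coeff_mul_add_eq_of_natDegree_le (h a (Finset.mem_insert_self a t)),
      ih fun i hi => h i (Finset.mem_insert_of_mem hi)]
    exact (natDegree_prod_le _ _).trans
      (Finset.sum_le_sum fun i hi => h i (Finset.mem_insert_of_mem hi))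

/-- In the Leibniz expansion each summand contributes the product of its top column coefficients.
Hence a nonsingular matrix of top coefficients certifies that a polynomial determinant is nonzero.
-/
theorem coeff_det_sum_of_natDegree_le {R : Type*} [CommRing R] {m : ℕ}
    (A : Matrix (Fin m) (Fin m) R[X]) (b : Fin m → ℕ) (h : ∀ k i, (A k i).natDegree ≤ b i) :
    A.det.coeff (∑ i, b i) = (Matrix.of fun k i => (A k i).coeff (b i)).det := by
  rw [Matrix.det_apply, Matrix.det_apply, finsetSum_coeff]
  refine Finset.sum_congr rfl fun σ _ => ?_
  rw [coeff_smul, coeff_prod_sum_of_natDegree_le _ _ _ fun i _ => h (σ i) i]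
  rfl

section Condenser

variable {K W : Type*} [Field K] [AddCommGroup W] [Module K W]

/-- A polynomial curve is a combination of linearly independent vectors, with monic polynomials of
distinct degrees as coefficients. -/
theorem exists_monic_decomposition (d : ℕ) (c : ℕ → W) :
    ∃ (m : ℕ) (δ : Fin m → ℕ) (P : Fin m → K[X]) (w : Fin m → W), Function.Injective δ ∧
      (∀ i, δ i < d) ∧ (∀ i, (P i).Monic ∧ (P i).natDegree = δ i) ∧ LinearIndependent K w ∧
      ∀ z : K, ∑ a ∈ Finset.range d, z ^ a • c a = ∑ i, (P i).eval z • w i := by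
  induction d generalizing c with
  | zero =>
    exact ⟨0, Fin.elim0, Fin.elim0, Fin.elim0, fun i => i.elim0, fun i => i.elim0,
      fun i => i.elim0, linearIndependent_empty_type, by simp⟩
  | succ d ih =>
    -- The curve is c 0 + z · (shifted curve). Multiplication by z raises all degrees by one, which
    -- frees degree 0 for c 0 if it is a new direction; otherwise c 0 only changes constant terms.
    obtain ⟨m, δ, P, w, hδ, hlt, hP, hw, hsum⟩ := ih fun a => c (a + 1)
    have key : ∀ z : K, ∑ a ∈ Finset.range (d + 1), z ^ a • c a =
        c 0 + ∑ i, (z * (P i).eval z) • w i := by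
      intro z
      rw [Finset.sum_range_succ', add_comm]
      simp only [pow_zero, one_smul, mul_smul, ← Finset.smul_sum, ← hsum, pow_succ']
    by_cases hc : c 0 ∈ Submodule.span K (Set.range w)
    · obtain ⟨l, hl⟩ := (Submodule.mem_span_range_iff_exists_fun K).1 hc
      refine ⟨m, fun i => δ i + 1, fun i => X * P i + C (l i), w,
        fun i j h => hδ (Nat.succ_injective h), fun i => Nat.succ_lt_succ (hlt i), fun i => ?_,
        hw, fun z => ?_⟩
      · have hm : (X * P i).Monic := monic_X.mul (hP i).1
        have hd : (X * P i).natDegree = δ i + 1 := by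
          rw [natDegree_X_mul (hP i).1.ne_zero, (hP i).2]
        refine ⟨hm.add_of_left (degree_C_le.trans_lt ?_), by rw [natDegree_add_C, hd]⟩
        rw [degree_eq_natDegree hm.ne_zero, hd]
        exact_mod_cast Nat.succ_pos _
      · rw [key, ← hl, ← Finset.sum_add_distrib]
        refine Finset.sum_congr rfl fun i _ => ?_
        simp [add_smul, add_comm]
    · refine ⟨m + 1, Fin.cons 0 fun i => δ i + 1, Fin.cons 1 fun i => X * P i, Fin.cons (c 0) w,
        ?_, ?_, ?_, linearIndependent_finCons.2 ⟨hw, hc⟩, ?_⟩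
      · refine Fin.cons_injective_iff.2 ⟨?_, fun i j h => hδ (Nat.succ_injective h)⟩
        rintro ⟨i, hi⟩
        exact Nat.succ_ne_zero _ hi
      · exact Fin.cases (Nat.succ_pos _) fun i => Nat.succ_lt_succ (hlt i)
      · refine Fin.cases ⟨monic_one, natDegree_one⟩ fun i => ⟨monic_X.mul (hP i).1, ?_⟩
        simp [natDegree_X_mul (hP i).1.ne_zero, (hP i).2]
      · intro z
        simp [key, Fin.sum_univ_succ]

/-- The values of a polynomial curve of degree less than `d` at the points
`α, g * α, …, g ^ (s - 1) * α` span all its values, for all but finitely many `α`, if the powers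
`1, g, …, g ^ (d - 1)` are distinct and `s` is at least the dimension. -/
theorem finite_setOf_not_mem_span_values [FiniteDimensional K W] (g : K) (d s : ℕ)
    (hg : Set.InjOn (fun a => g ^ a) (Set.Iio d)) (hs : Module.finrank K W ≤ s) (c : ℕ → W) :
    {α : K | ¬ ∀ z : K, ∑ a ∈ Finset.range d, z ^ a • c a ∈ Submodule.span K
      (Set.range fun k : Fin s => ∑ a ∈ Finset.range d, (g ^ (k : ℕ) * α) ^ a • c a)}.Finite := by
  obtain ⟨m, δ, P, w, hδ, hlt, hP, hw, hsum⟩ := exists_monic_decomposition (K := K) d c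
  have hms : m ≤ s := by
    simpa using hw.fintype_card_le_finrank.trans hs
  -- Row k expresses the curve at g^k α in the basis w, with α as the indeterminate. Its top
  -- coefficients form a transposed Vandermonde matrix with the distinct nodes g^(δ i).
  let A : Matrix (Fin m) (Fin m) K[X] :=
    Matrix.of fun k i => (P i).comp (C (g ^ (k : ℕ)) * X)
  have hdeg : ∀ k i, (A k i).natDegree ≤ δ i := fun k i => by
    refine natDegree_comp_le.trans ?_
    rw [(hP i).2]
    exact (Nat.mul_le_mul_left _ ((natDegree_C_mul_le _ _).trans natDegree_X_le)).trans (mul_one _).le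
  have hcoeff : ∀ k i, (A k i).coeff (δ i) = (g ^ δ i) ^ (k : ℕ) := fun k i => by
    simp only [A, Matrix.of_apply]
    rw [comp_C_mul_X_coeff, ← (hP i).2, coeff_natDegree, (hP i).1.leadingCoeff, one_mul,
      ← pow_mul, ← pow_mul, mul_comm]
  have hdet : A.det ≠ 0 := by
    intro h0
    have h1 := coeff_det_sum_of_natDegree_le A δ hdeg
    rw [h0, coeff_zero] at h1
    have h2 : (Matrix.of fun k i => (A k i).coeff (δ i)) =
        (Matrix.vandermonde fun i => g ^ δ i).transpose := by
      ext k i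
      simp [hcoeff, Matrix.vandermonde_apply]
    rw [h2, Matrix.det_transpose] at h1
    exact (Matrix.det_vandermonde_ne_zero_iff.2
      fun i j h => hδ (hg (hlt i) (hlt j) h)) h1.symm
  refine (A.det.finite_setOfPred_isRoot hdet).subset fun α hα => ?_
  by_contra hroot
  refine hα fun z => ?_
  -- If α is not a root of the determinant, inverting E recovers every w i from the first m values.
  let E : Matrix (Fin m) (Fin m) K := Matrix.of fun k i => (P i).eval (g ^ (k : ℕ) * α)
  have hE : IsUnit E.det := by
    refine isUnit_iff_ne_zero.2 fun h => hroot ?_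
    have : E = (evalRingHom α).mapMatrix A := by
      ext k i
      simp [E, A, eval_comp]
    rw [this, ← RingHom.map_det] at h
    exact h
  have hmem : ∀ i, w i ∈ Submodule.span K
      (Set.range fun k : Fin s => ∑ a ∈ Finset.range d, (g ^ (k : ℕ) * α) ^ a • c a) := by
    intro i
    have : w i = ∑ k, E⁻¹ i k • ∑ a ∈ Finset.range d, (g ^ (k : ℕ) * α) ^ a • c a := by
      simp only [hsum, Finset.smul_sum, smul_smul]
      rw [Finset.sum_comm]
      simp only [← Finset.sum_smul]
      have h1 : ∀ j, ∑ k, E⁻¹ i k * (P j).eval (g ^ (k : ℕ) * α) = (1 : Matrix _ _ K) i j := by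
        intro j
        rw [← Matrix.nonsing_inv_mul E hE]
        rfl
      simp [h1, Matrix.one_apply]
    rw [this]
    exact Submodule.sum_mem _ fun k _ => Submodule.smul_mem _ _
      (Submodule.subset_span ⟨Fin.castLE hms k, rfl⟩)
  rw [hsum]
  exact Submodule.sum_mem _ fun i _ => Submodule.smul_mem _ _ (hmem i)

end Condenser

/-! ### The recursive points. -/

section BlockPoint

variable {F : Type*} [Field F] {R R' : Type*} [CommRing R] [Algebra F R] [CommRing R'] [Algebra F R']

/-- A pair of indices below `s` is coded as a number `t` below `s * s`; the block `i` uses the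
first or the second one, according to the `l`-th bit of `i`. -/
def childIndex (s l i t : ℕ) : ℕ :=
  if i / 2 ^ l % 2 = 0 then t / s else t % s

/-- The `k`-th point on level `l` of the recursive construction: its coordinate `j` in the
block `i`. A curve through `s * s` combinations of points of the previous level, with nodes `c`, is
evaluated at `g ^ k * α l`. -/
def blockPoint (c : ℕ → F) (s : ℕ) (g : F) (α : ℕ → R) : ℕ → ℕ → ℕ → ℕ → R
  | 0, _, k, j => if k = j then 1 else 0
  | l + 1, i, k, j => ∑ t ∈ Finset.range (s * s),
      aeval (algebraMap F R g ^ k * α l) (Lagrange.basis (Finset.range (s * s)) c t) *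
        blockPoint c s g α l i (childIndex s l i t) j

variable (c : ℕ → F) (s : ℕ) (g : F)

/-- Naturality in the coefficient ring allows a seed to be an indeterminate that is specialised
later, and nonvanishing to descend from an extension field to F. -/
theorem map_blockPoint (φ : R →ₐ[F] R') (α : ℕ → R) (l i k j : ℕ) :
    φ (blockPoint c s g α l i k j) = blockPoint c s g (fun m => φ (α m)) l i k j := by
  induction l generalizing k with
  | zero => simp only [blockPoint]; split_ifs <;> simp
  | succ l ih =>
    simp only [blockPoint, map_sum, map_mul, ih, ← aeval_algHom_apply, map_pow, AlgHom.commutes]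

theorem blockPoint_congr {α β : ℕ → R} {l : ℕ} (h : ∀ m < l, α m = β m) (i k j : ℕ) :
    blockPoint c s g α l i k j = blockPoint c s g β l i k j := by
  induction l generalizing k with
  | zero => rfl
  | succ l ih =>
    simp only [blockPoint, h l l.lt_succ_self, ih fun m hm => h m (hm.trans l.lt_succ_self)]

/-- All points of a level lie on one curve, so the choice of k amounts to scaling the top seed. -/
theorem blockPoint_update_mul (α : ℕ → R) (l i k j : ℕ) (z : R) :
    blockPoint c s g (Function.update α l z) (l + 1) i k j =
      blockPoint c s g (Function.update α l (algebraMap F R g ^ k * z)) (l + 1) i 0 j := by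
  simp only [blockPoint, Function.update_self, pow_zero, one_mul]
  refine Finset.sum_congr rfl fun t _ => ?_
  congr 1
  exact blockPoint_congr c s g (fun m hm => by simp [hm.ne]) i _ j

/-- At a node of the interpolation only one Lagrange polynomial survives: the curve meets every
prescribed combination of points of the level below. -/
theorem blockPoint_update_node {c : ℕ → F} (hc : Set.InjOn c (Finset.range (s * s)))
    (α : ℕ → R) (l i j : ℕ) {t : ℕ} (ht : t < s * s) :
    blockPoint c s g (Function.update α l (algebraMap F R (c t))) (l + 1) i 0 j =
      blockPoint c s g α l i (childIndex s l i t) j := by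
  have ht' := Finset.mem_range.2 ht
  simp only [blockPoint, Function.update_self, pow_zero, one_mul, aeval_algebraMap_apply]
  rw [Finset.sum_eq_single_of_mem t ht', coe_aeval_eq_eval, Lagrange.eval_basis_self hc ht',
    map_one, one_mul]
  · exact blockPoint_congr c s g (fun m hm => by simp [hm.ne]) i _ j
  · intro u _ hu
    rw [coe_aeval_eq_eval, Lagrange.eval_basis_of_ne hu ht', map_zero, zero_mul]

theorem natDegree_aeval_le {K : Type*} [Field K] [Algebra F K] (p : F[X]) (z : K[X]) :
    (aeval z p).natDegree ≤ p.natDegree * z.natDegree := by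
  rw [aeval_eq_sum_range]
  refine natDegree_sum_le_of_forall_le _ _ fun i hi => ?_
  rw [Algebra.smul_def, IsScalarTower.algebraMap_apply F K K[X], algebraMap_eq]
  refine (natDegree_C_mul_le _ _).trans (natDegree_pow_le.trans ?_)
  exact Nat.mul_le_mul_right _ (Nat.lt_succ_iff.1 (Finset.mem_range.1 hi))

/-- Seed m enters at a single step, from level m to m + 1, through Lagrange polynomials of degree s²
- 1. The later steps only take combinations with constant coefficients. -/
theorem natDegree_blockPoint_le {K : Type*} [Field K] [Algebra F K] {c : ℕ → F}
    (hc : Set.InjOn c (Finset.range (s * s))) (α : ℕ → K) (m l i k j : ℕ) :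
    (blockPoint c s g (Function.update (fun q => C (α q)) m X) l i k j).natDegree ≤
      if m < l then s * s - 1 else 0 := by
  induction l generalizing k with
  | zero => simp only [blockPoint]; split_ifs <;> simp
  | succ l ih =>
    rw [blockPoint]
    refine natDegree_sum_le_of_forall_le _ _ fun t ht => natDegree_mul_le.trans ?_
    have h1 := natDegree_aeval_le (Lagrange.basis (Finset.range (s * s)) c t)
      (algebraMap F K[X] g ^ k * Function.update (fun q => C (α q)) m X l)
    rw [Lagrange.natDegree_basis hc ht, Finset.card_range] at h1
    have h2 := ih (childIndex s l i t)
    have h3 : (algebraMap F K[X] g ^ k * Function.update (fun q => C (α q)) m X l).natDegree ≤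
        if m = l then 1 else 0 := by
      rw [IsScalarTower.algebraMap_apply F K K[X], algebraMap_eq, ← C_pow]
      refine (natDegree_C_mul_le _ _).trans ?_
      rcases eq_or_ne m l with rfl | h
      · simp
      · simp [h, h.symm]
    rcases lt_trichotomy m l with h | h | h
    · rw [if_neg h.ne] at h3
      rw [if_pos h] at h2
      rw [if_pos (by omega)]
      have := h1.trans (Nat.mul_le_mul_left _ h3)
      omega
    · rw [if_pos h] at h3
      rw [if_neg (by omega)] at h2
      rw [if_pos (by omega)]
      have := h1.trans (Nat.mul_le_mul_left _ h3)
      omega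
    · rw [if_neg h.ne'] at h3
      rw [if_neg (by omega)] at h2
      rw [if_neg (by omega)]
      have := h1.trans (Nat.mul_le_mul_left _ h3)
      omega

end BlockPoint

/-! ### Matrix products along a binary tree. -/

section NodeMatrix

variable {F : Type*} [Field F] {R R' : Type*} [CommRing R] [Algebra F R] [CommRing R'] [Algebra F R']
  {ι : Type*} [Fintype ι] [DecidableEq ι]

/-- The matrix `∑ j, x i j * A i j` of block `i < D`; the identity matrix for `i ≥ D`. -/
def blockMatrix (A : ℕ → ℕ → Matrix ι ι F) (D n : ℕ) (x : ℕ → ℕ → R) (i : ℕ) : Matrix ι ι R :=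
  if i < D then ∑ j ∈ Finset.range n, x i j • (A i j).map (algebraMap F R) else 1

/-- The product of the matrices of the blocks `q * 2 ^ l, …, (q + 1) * 2 ^ l - 1`. -/
def nodeMatrix (A : ℕ → ℕ → Matrix ι ι F) (D n : ℕ) (x : ℕ → ℕ → R) : ℕ → ℕ → Matrix ι ι R
  | 0, q => blockMatrix A D n x q
  | l + 1, q => nodeMatrix A D n x l (2 * q) * nodeMatrix A D n x l (2 * q + 1)

variable (A : ℕ → ℕ → Matrix ι ι F) (D n : ℕ)

theorem map_nodeMatrix (φ : R →ₐ[F] R') (x : ℕ → ℕ → R) (l q : ℕ) :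
    (nodeMatrix A D n x l q).map φ = nodeMatrix A D n (fun i j => φ (x i j)) l q := by
  induction l generalizing q with
  | zero =>
    simp only [nodeMatrix, blockMatrix]
    split_ifs
    · ext u v
      simp [Matrix.sum_apply]
    · exact φ.mapMatrix.map_one
  | succ l ih =>
    simp only [nodeMatrix, ← ih]
    exact φ.mapMatrix.map_mul _ _

/-- A node reads only its own blocks. Two siblings can therefore be given different points, as
`childIndex` does. -/
theorem nodeMatrix_congr {x y : ℕ → ℕ → R} {l q : ℕ}
    (h : ∀ i, i / 2 ^ l = q → ∀ j, x i j = y i j) :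
    nodeMatrix A D n x l q = nodeMatrix A D n y l q := by
  induction l generalizing q with
  | zero => simp only [nodeMatrix, blockMatrix, h q (by simp)]
  | succ l ih =>
    have key : ∀ i p, i / 2 ^ l = p → p / 2 = q → ∀ j, x i j = y i j := fun i p hi hp j =>
      h i (by rw [pow_succ, ← Nat.div_div_eq_div_mul, hi, hp]) j
    rw [nodeMatrix, nodeMatrix, ih fun i hi => key i _ hi (by omega),
      ih fun i hi => key i _ hi (by omega)]

/-- The minimum bounds the number of blocks of the node with index below D. Identity blocks add no
degree, so the bound is governed by D and not by the power of two above it. -/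
theorem natDegree_nodeMatrix_le {K : Type*} [Field K] [Algebra F K] (x : ℕ → ℕ → K[X]) (E : ℕ)
    (hx : ∀ i j, (x i j).natDegree ≤ E) (l q : ℕ) (u v : ι) :
    (nodeMatrix A D n x l q u v).natDegree ≤ min (2 ^ l) (D - q * 2 ^ l) * E := by
  induction l generalizing q u v with
  | zero =>
    simp only [nodeMatrix, blockMatrix]
    split_ifs with hq
    · rw [Matrix.sum_apply]
      refine natDegree_sum_le_of_forall_le _ _ fun j _ => ?_
      rw [Matrix.smul_apply, Matrix.map_apply, smul_eq_mul,
        IsScalarTower.algebraMap_apply F K K[X], algebraMap_eq]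
      refine (natDegree_mul_C_le _ _).trans ((hx q j).trans ?_)
      have : min (2 ^ 0) (D - q * 2 ^ 0) = 1 := by
        rw [pow_zero]; omega
      rw [this, one_mul]
    · rw [Matrix.one_apply]
      split_ifs <;> simp
  | succ l ih =>
    rw [nodeMatrix, Matrix.mul_apply]
    refine natDegree_sum_le_of_forall_le _ _ fun w _ => natDegree_mul_le.trans ?_
    refine (Nat.add_le_add (ih _ _ _) (ih _ _ _)).trans ?_
    rw [← Nat.add_mul]
    refine Nat.mul_le_mul_right _ ?_
    have h1 : 2 * q * 2 ^ l = q * 2 ^ (l + 1) := by ring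
    have h2 : (2 * q + 1) * 2 ^ l = q * 2 ^ (l + 1) + 2 ^ l := by ring
    have h3 : 2 ^ (l + 1) = 2 ^ l + 2 ^ l := by ring
    rw [h1, h2]
    omega

end NodeMatrix

/-! ### Spanning sets of node values, and the choice of seeds. -/

section Span

variable {F K : Type*} [Field F] [Field K] [Algebra F K] {ι : Type*} [Fintype ι] [DecidableEq ι]
  (A : ℕ → ℕ → Matrix ι ι F) (D n s : ℕ) (c : ℕ → F) (g : F)

/-- The product matrix of a node at the `k`-th point of its level. -/
def nodeValue {R : Type*} [CommRing R] [Algebra F R] (α : ℕ → R) (l q k : ℕ) : Matrix ι ι R :=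
  nodeMatrix A D n (fun i j => blockPoint c s g α l i k j) l q

theorem map_nodeValue {R R' : Type*} [CommRing R] [Algebra F R] [CommRing R'] [Algebra F R']
    (φ : R →ₐ[F] R') (α : ℕ → R) (l q k : ℕ) :
    (nodeValue A D n s c g α l q k).map φ =
      nodeValue A D n s c g (fun m => φ (α m)) l q k := by
  simp only [nodeValue, map_nodeMatrix, map_blockPoint]

theorem nodeValue_congr {R : Type*} [CommRing R] [Algebra F R] {α β : ℕ → R} {l : ℕ}
    (h : ∀ m < l, α m = β m) (q k : ℕ) :
    nodeValue A D n s c g α l q k = nodeValue A D n s c g β l q k := by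
  simp only [nodeValue, blockPoint_congr c s g h]

theorem nodeValue_update_mul {R : Type*} [CommRing R] [Algebra F R] (α : ℕ → R) (l q k : ℕ)
    (z : R) :
    nodeValue A D n s c g (Function.update α l z) (l + 1) q k =
      nodeValue A D n s c g (Function.update α l (algebraMap F R g ^ k * z)) (l + 1) q 0 := by
  simp only [nodeValue, blockPoint_update_mul c s g α l _ k]

variable {c}

/-- As a function of one of the seeds, the value of a node is a matrix of polynomials of degree at
most `D * (s * s - 1)`. -/
theorem exists_polynomial_nodeValue (hc : Set.InjOn c (Finset.range (s * s))) (α : ℕ → K)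
    (m l q k : ℕ) : ∃ N : Matrix ι ι K[X], (∀ u v, (N u v).natDegree ≤ D * (s * s - 1)) ∧
      ∀ z, nodeValue A D n s c g (Function.update α m z) l q k = N.map (eval z) := by
  -- The m-th seed becomes the indeterminate and the others stay constant; naturality under
  -- evaluation at z gives the second claim.
  refine ⟨nodeValue A D n s c g (Function.update (fun p => C (α p)) m X) l q k,
    fun u v => ?_, fun z => ?_⟩
  · refine (natDegree_nodeMatrix_le A D n _ (s * s - 1) (fun i j => ?_) l q u v).trans
      (Nat.mul_le_mul_right _ ((min_le_right _ _).trans (Nat.sub_le _ _)))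
    refine (natDegree_blockPoint_le s g hc α m l i k j).trans ?_
    split_ifs <;> simp
  · have h := map_nodeValue A D n s c g ((aeval z : K[X] →ₐ[K] K).restrictScalars F)
      (Function.update (fun p => C (α p)) m X) l q k
    have h2 : (fun p => ((aeval z : K[X] →ₐ[K] K).restrictScalars F)
        (Function.update (fun p => C (α p)) m X p)) = Function.update α m z := by
      funext p
      rcases eq_or_ne p m with rfl | hp <;> simp [*]
    rw [h2] at h
    rw [← h]
    ext u v
    simp

/-- With t = a s + b, the blocks of the left child have bit l equal to 0 and use t / s = a; those of
the right child use t % s = b. -/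
theorem nodeValue_update_node (hc : Set.InjOn c (Finset.range (s * s))) (α : ℕ → K)
    (l q : ℕ) {a b : ℕ} (ha : a < s) (hb : b < s) :
    nodeValue A D n s c g (Function.update α l (algebraMap F K (c (a * s + b)))) (l + 1) q 0 =
      nodeValue A D n s c g α l (2 * q) a * nodeValue A D n s c g α l (2 * q + 1) b := by
  have hs : 0 < s := by omega
  have ht : a * s + b < s * s := by nlinarith
  simp only [nodeValue, blockPoint_update_node s g hc α l _ _ ht, nodeMatrix]
  have hdiv : (a * s + b) / s = a := by
    rw [mul_comm, Nat.mul_add_div hs, Nat.div_eq_of_lt hb, add_zero]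
  have hmod : (a * s + b) % s = b := by
    rw [mul_comm, Nat.mul_add_mod, Nat.mod_eq_of_lt hb]
  congr 1
  · refine nodeMatrix_congr A D n fun i hi j => ?_
    rw [childIndex, hi, if_pos (by omega), hdiv]
  · refine nodeMatrix_congr A D n fun i hi j => ?_
    rw [childIndex, hi, if_neg (by omega), hmod]

/-- For suitable seeds, the `s` points of a level suffice to span all values of the nodes. -/
theorem exists_seeds_span [Infinite K] (hD : 1 ≤ D) (hs : 1 ≤ s) (hn : n ≤ s)
    (hι : Fintype.card ι * Fintype.card ι ≤ s) (hc : Set.InjOn c (Finset.range (s * s)))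
    (hg : Set.InjOn (fun a => g ^ a) (Set.Iio (D * (s * s)))) (l Q : ℕ) :
    ∃ α : ℕ → K, ∀ q < Q, ∀ x : ℕ → ℕ → K, nodeMatrix A D n x l q ∈
      Submodule.span K (Set.range fun k : Fin s => nodeValue A D n s c g α l q k) := by
  induction l generalizing Q with
  | zero =>
    refine ⟨0, fun q _ x => ?_⟩
    -- On level 0 the points are unit vectors, which pick out the coefficient matrices; indices from
    -- n up to s give zero.
    have h0 : (fun k : Fin s => nodeValue A D n s c g (0 : ℕ → K) 0 q k) = fun k : Fin s =>
        if q < D then (if (k : ℕ) < n then (A q k).map (algebraMap F K) else 0) else 1 := by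
      funext k
      simp only [nodeValue, nodeMatrix, blockMatrix, blockPoint]
      split_ifs with h1 h2
      · rw [Finset.sum_eq_single_of_mem (k : ℕ) (Finset.mem_range.2 h2)]
        · simp
        · intro j _ hj
          simp [hj.symm]
      · refine Finset.sum_eq_zero fun j hj => ?_
        rw [if_neg, zero_smul]
        rintro rfl
        exact h2 (Finset.mem_range.1 hj)
      · rfl
    rw [h0]
    simp only [nodeMatrix, blockMatrix]
    split_ifs with h1
    · refine Submodule.sum_mem _ fun j hj => Submodule.smul_mem _ _ (Submodule.subset_span ?_)
      have hj' := Finset.mem_range.1 hj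
      exact ⟨⟨j, hj'.trans_le hn⟩, by simp [hj']⟩
    · exact Submodule.subset_span ⟨⟨0, hs⟩, rfl⟩
  | succ l ih =>
    -- The Q nodes considered have 2Q children.
    obtain ⟨α, hα⟩ := ih (2 * Q)
    choose N hNdeg hN using fun q => exists_polynomial_nodeValue A D n s g hc α l (l + 1) q 0
    have hNsum : ∀ q z, nodeValue A D n s c g (Function.update α l z) (l + 1) q 0 =
        ∑ a ∈ Finset.range (D * (s * s)), z ^ a • (N q).map (fun p => p.coeff a) := by
      intro q z
      rw [hN]
      ext u v
      have hpos : 0 < D * (s * s) := by positivity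
      have hlt : (N q u v).natDegree < D * (s * s) := by
        refine (hNdeg q u v).trans_lt ?_
        rw [Nat.mul_sub, mul_one]
        omega
      rw [Matrix.map_apply, eval_eq_sum_range' hlt, Matrix.sum_apply]
      simp [mul_comm]
    have hg' : Set.InjOn (fun a => algebraMap F K g ^ a) (Set.Iio (D * (s * s))) := by
      intro a ha b hb hab
      refine hg ha hb ((algebraMap F K).injective ?_)
      simpa using hab
    have hrank : Module.finrank K (Matrix ι ι K) ≤ s := by
      rwa [Module.finrank_matrix, Module.finrank_self, mul_one]
    -- One new seed must serve all Q nodes. Finitely many finite exceptional sets leave such a seed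
    -- because K is infinite.
    have hfin : (⋃ q ∈ Finset.range Q, _).Finite := Set.Finite.biUnion (Finset.finite_toSet _)
      fun q _ => finite_setOf_not_mem_span_values (algebraMap F K g) (D * (s * s)) s hg' hrank
        fun a => (N q).map (fun p => p.coeff a)
    obtain ⟨β, hβ⟩ := hfin.infinite_compl.nonempty
    refine ⟨Function.update α l β, fun q hq x => ?_⟩
    have hβq : ∀ z, nodeValue A D n s c g (Function.update α l z) (l + 1) q 0 ∈
        Submodule.span K (Set.range fun k : Fin s =>
          nodeValue A D n s c g (Function.update α l β) (l + 1) q k) := by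
      simp only [nodeValue_update_mul A D n s c g α l q _ β, hNsum]
      by_contra hcon
      exact hβ (Set.mem_biUnion (Finset.mem_coe.2 (Finset.mem_range.2 hq)) hcon)
    rw [nodeMatrix]
    -- A product of elements of two spans lies in the span of products of generators, and each such
    -- product is a value on the curve.
    have hmul := Submodule.mul_mem_mul (hα (2 * q) (by omega) x) (hα (2 * q + 1) (by omega) x)
    rw [Submodule.span_mul_span] at hmul
    refine Submodule.span_le.2 ?_ hmul
    rintro _ ⟨_, ⟨a, rfl⟩, _, ⟨b, rfl⟩, rfl⟩
    have := hβq (algebraMap F K (c (a * s + b)))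
    rwa [nodeValue_update_node A D n s g hc α l q a.2 b.2] at this

/-- The seeds can be taken from any set of more than `D * (s * s - 1)` field elements. -/
theorem exists_seeds_ne_zero [Infinite K] (hD : 1 ≤ D) (hs : 1 ≤ s) (hn : n ≤ s)
    (hι : Fintype.card ι * Fintype.card ι ≤ s) (hc : Set.InjOn c (Finset.range (s * s)))
    (hg : Set.InjOn (fun a => g ^ a) (Set.Iio (D * (s * s)))) (e : ℕ → F) (B : ℕ)
    (he : Set.InjOn e (Set.Iio B)) (hB : D * (s * s - 1) < B) (l : ℕ) (x : ℕ → ℕ → K) (u v : ι)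
    (hx : nodeMatrix A D n x (l + 1) 0 u v ≠ 0) :
    ∃ a : ℕ → ℕ, (∀ m, a m < B) ∧
      nodeValue A D n s c g (fun m => e (a m)) (l + 1) 0 0 u v ≠ 0 := by
  obtain ⟨α, hα⟩ := exists_seeds_span (K := K) A D n s g hD hs hn hι hc hg (l + 1) 1
  obtain ⟨k, hk⟩ : ∃ k : Fin s, nodeValue A D n s c g α (l + 1) 0 k u v ≠ 0 := by
    by_contra! hcon
    refine hx ?_
    have hle : Submodule.span K (Set.range fun k : Fin s => nodeValue A D n s c g α (l + 1) 0 k) ≤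
        LinearMap.ker (Matrix.entryLinearMap K K u v) := by
      rw [Submodule.span_le]
      rintro _ ⟨k, rfl⟩
      exact hcon k
    exact hle (hα 0 one_pos x)
  have hβ : ∃ β : ℕ → K, nodeValue A D n s c g β (l + 1) 0 0 u v ≠ 0 := by
    refine ⟨Function.update α l (algebraMap F K g ^ (k : ℕ) * α l), ?_⟩
    rwa [← nodeValue_update_mul, Function.update_eq_self]
  obtain ⟨β, hβ⟩ := hβ
  -- Hybrid argument: seeds below m are already enumerated elements, the others are still those from
  -- K. Each replacement avoids the roots of a nonzero polynomial of degree less than B.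
  have hgrid : ∀ m, ∃ a : ℕ → ℕ, (∀ p, a p < B) ∧ nodeValue A D n s c g
      (fun p => if p < m then algebraMap F K (e (a p)) else β p) (l + 1) 0 0 u v ≠ 0 := by
    intro m
    induction m with
    | zero => exact ⟨0, fun _ => by simpa using (Nat.zero_le _).trans_lt hB, by simpa using hβ⟩
    | succ m ih =>
      obtain ⟨a, haB, ha⟩ := ih
      obtain ⟨N, hNdeg, hN⟩ := exists_polynomial_nodeValue A D n s g hc
        (fun p => if p < m then algebraMap F K (e (a p)) else β p) m (l + 1) 0 0
      have hN0 : N u v ≠ 0 := by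
        intro h0
        have := congrFun₂ (hN (β m)) u v
        rw [Matrix.map_apply, h0, eval_zero, Function.update_eq_self_iff.2 (by simp)] at this
        exact ha this
      obtain ⟨b, hb⟩ : ∃ b : Fin B, (N u v).eval (algebraMap F K (e b)) ≠ 0 := by
        by_contra! hcon
        refine hN0 (eq_zero_of_natDegree_lt_card_of_eval_eq_zero _ ?_ hcon ?_)
        · intro b b' h
          exact Fin.ext (he b.2 b'.2 ((algebraMap F K).injective h))
        · rw [Fintype.card_fin]
          exact (hNdeg u v).trans_lt hB
      refine ⟨Function.update a m b, fun p => ?_, ?_⟩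
      · rcases eq_or_ne p m with rfl | hp
        · simp
        · simp [hp, haB]
      · have := congrFun₂ (hN (algebraMap F K (e b))) u v
        rw [Matrix.map_apply] at this
        rw [← this] at hb
        convert hb using 4 with p
        rcases lt_trichotomy p m with h | rfl | h
        · simp [h, h.ne, h.trans m.lt_succ_self]
        · simp
        · simp [h.ne', not_lt.2 h.le, not_lt.2 (Nat.succ_le_of_lt h)]
  obtain ⟨a, haB, ha⟩ := hgrid (l + 1)
  -- All relevant seeds now come from F, so the value is the image of a value over F.
  refine ⟨a, haB, fun h0 => ha ?_⟩
  rw [nodeValue_congr A D n s c g (β := fun m => Algebra.ofId F K (e (a m)))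
    (fun m hm => by simp [hm, Algebra.ofId_apply]), ← map_nodeValue, Matrix.map_apply, h0, map_zero]

end Span

/-! ### Branching programs as matrix products. -/

section PathSum

variable {R : Type*} [CommRing R] {ι : Type*} [Fintype ι] [DecidableEq ι]

/-- A product of matrices is a sum over walks. -/
theorem sum_walks_eq_dotProduct (M : ℕ → Matrix ι ι R) (D : ℕ) (f h : ι → R) :
    ∑ p : Fin (D + 1) → ι, f (p 0) * (∏ i : Fin D, M i (p i.castSucc) (p i.succ)) *
      h (p (Fin.last D)) = f ⬝ᵥ ((((List.range D).map M).prod).mulVec h) := by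
  induction D generalizing h with
  | zero =>
    rw [← (Equiv.funUnique (Fin 1) ι).symm.sum_comp]
    simp [dotProduct]
  | succ D ih =>
    rw [← (Fin.snocEquiv fun _ : Fin (D + 2) => ι).sum_comp, Fintype.sum_prod_type,
      Finset.sum_comm, List.range_succ, List.map_append, List.prod_append, List.map_singleton,
      List.prod_singleton, ← Matrix.mulVec_mulVec, ← ih]
    refine Finset.sum_congr rfl fun p _ => ?_
    rw [Matrix.mulVec, dotProduct, Finset.mul_sum]
    refine Finset.sum_congr rfl fun w _ => ?_
    rw [Fin.prod_univ_castSucc]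
    have h0 : (Fin.snocEquiv fun _ : Fin (D + 2) => ι) (w, p) 0 = p 0 := by
      simp
    have h1 : ∀ i : Fin (D + 1), (Fin.snocEquiv fun _ : Fin (D + 2) => ι) (w, p) i.castSucc = p i :=
      fun i => Fin.snoc_castSucc (α := fun _ => ι) w p i
    have h2 : (Fin.snocEquiv fun _ : Fin (D + 2) => ι) (w, p) (Fin.last (D + 1)) = w :=
      Fin.snoc_last (α := fun _ => ι) w p
    simp only [h0, h1, h2, Fin.succ_last, ← Fin.castSucc_succ, Fin.val_castSucc, Fin.val_last]
    ring

end PathSum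

section Branching

variable {F : Type*} [Field F] {R : Type*} [CommRing R] [Algebra F R]

theorem nodeMatrix_eq_prod {ι : Type*} [Fintype ι] [DecidableEq ι] (A : ℕ → ℕ → Matrix ι ι F)
    (D n : ℕ) (x : ℕ → ℕ → R) (l q : ℕ) :
    nodeMatrix A D n x l q =
      ((List.range' (q * 2 ^ l) (2 ^ l)).map (blockMatrix A D n x)).prod := by
  induction l generalizing q with
  | zero => simp [nodeMatrix]
  | succ l ih =>
    have h1 : 2 ^ (l + 1) = 2 ^ l + 2 ^ l := by ring
    have h2 : q * (2 ^ l + 2 ^ l) = 2 * q * 2 ^ l := by ring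
    have h3 : (2 * q + 1) * 2 ^ l = 2 * q * 2 ^ l + 2 ^ l := by ring
    rw [nodeMatrix, ih, ih, h1, h2, h3, ← List.prod_append, ← List.map_append,
      List.range'_append_1]

/-- The blocks from D to 2^l - 1 are identity matrices, so D need not be a power of two. -/
theorem nodeMatrix_zero_eq_prod {ι : Type*} [Fintype ι] [DecidableEq ι]
    (A : ℕ → ℕ → Matrix ι ι F) (D n : ℕ) (x : ℕ → ℕ → R) {l : ℕ} (hl : D ≤ 2 ^ l) :
    nodeMatrix A D n x l 0 = ((List.range D).map (blockMatrix A D n x)).prod := by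
  obtain ⟨m, hm⟩ := Nat.exists_eq_add_of_le hl
  have h1 : ((List.range' D m).map (blockMatrix A D n x)).prod = 1 := by
    refine List.prod_eq_one fun B hB => ?_
    obtain ⟨i, hi, rfl⟩ := List.mem_map.1 hB
    have : ¬ i < D := not_lt.2 (List.mem_range'_1.1 hi).1
    rw [blockMatrix, if_neg this]
  have h2 := List.range'_append_1 (s := 0) (m := D) (n := m)
  rw [zero_add] at h2
  rw [nodeMatrix_eq_prod, hm, zero_mul, ← h2, List.map_append, List.prod_append, h1, mul_one,
    List.range_eq_range']

open Classical in
/-- The coefficient of `x (i, j)` in the linear form on the edge `u → v` from level `i` to level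
`i + 1`, and zero if there is no such edge. -/
def SetMultilinearABP.coeffMatrix {D n : ℕ} (A : SetMultilinearABP F D n) (r i j : ℕ) :
    Matrix (Fin r) (Fin r) F :=
  Matrix.of fun u v =>
    if h : (∃ hi : i < D, (u : ℕ) < A.size (Fin.castSucc ⟨i, hi⟩) ∧
      (v : ℕ) < A.size (Fin.succ ⟨i, hi⟩)) ∧ j < n then
      if A.Adj ⟨i, h.1.1⟩ ⟨u, h.1.2.1⟩ ⟨v, h.1.2.2⟩ then
        A.label ⟨i, h.1.1⟩ ⟨u, h.1.2.1⟩ ⟨v, h.1.2.2⟩ ⟨j, h.2⟩ else 0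
    else 0

-- Vertices are embedded into r slots per level; walks that leave the graph or use a missing edge
-- contribute zero. Source and sink both occupy slot 0.
open Classical in
theorem SetMultilinearABP.aeval_toPoly {D n r : ℕ} (hD : 1 ≤ D) (hr : 0 < r)
    (A : SetMultilinearABP F D n) (hA : A.width ≤ r) {l : ℕ} (hl : D ≤ 2 ^ l) (x : ℕ → ℕ → R) :
    MvPolynomial.aeval (fun p : Fin D × Fin n => x p.1 p.2) A.toPoly =
      nodeMatrix (A.coeffMatrix r) D n x l 0 ⟨0, hr⟩ ⟨0, hr⟩ := by
  have hsize : ∀ k, A.size k ≤ r := fun k => (Finset.le_sup (Finset.mem_univ k)).trans hA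
  have hentry : ∀ (i : Fin D) u v,
      blockMatrix (A.coeffMatrix r) D n x i (Fin.castLE (hsize _) u) (Fin.castLE (hsize _) v) =
        if A.Adj i u v then
          MvPolynomial.aeval (fun p : Fin D × Fin n => x p.1 p.2) (A.linearForm i u v) else 0 := by
    intro i u v
    rw [blockMatrix, if_pos i.2, Matrix.sum_apply, Finset.sum_range, linearForm, map_sum]
    by_cases h : A.Adj i u v
    · rw [if_pos h]
      refine Finset.sum_congr rfl fun j _ => ?_
      rw [Matrix.smul_apply, Matrix.map_apply, coeffMatrix, Matrix.of_apply,
        dif_pos ⟨⟨i.2, u.2, v.2⟩, j.2⟩]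
      simp [h, mul_comm]
    · rw [if_neg h]
      refine Finset.sum_eq_zero fun j _ => ?_
      rw [Matrix.smul_apply, Matrix.map_apply, coeffMatrix, Matrix.of_apply,
        dif_pos ⟨⟨i.2, u.2, v.2⟩, j.2⟩]
      simp [h]
  have hzero : ∀ (i : Fin D) (u v : Fin r),
      ¬ ((u : ℕ) < A.size i.castSucc ∧ (v : ℕ) < A.size i.succ) →
        blockMatrix (A.coeffMatrix r) D n x i u v = 0 := by
    intro i u v h
    rw [blockMatrix, if_pos i.2, Matrix.sum_apply]
    refine Finset.sum_eq_zero fun j _ => ?_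
    rw [Matrix.smul_apply, Matrix.map_apply, coeffMatrix, Matrix.of_apply,
      dif_neg fun h' => h h'.1.2, map_zero, smul_zero]
  have hwalk := sum_walks_eq_dotProduct (blockMatrix (A.coeffMatrix r) D n x) D
    (Pi.single ⟨0, hr⟩ 1) (Pi.single ⟨0, hr⟩ 1)
  rw [Matrix.mulVec_single_one, single_one_dotProduct] at hwalk
  rw [nodeMatrix_zero_eq_prod _ _ _ _ hl]
  refine Eq.trans ?_ hwalk
  rw [toPoly, map_sum, Finset.sum_filter]
  refine Finset.sum_of_injOn (fun p k => Fin.castLE (hsize k) (p k)) ?_ (by simp) ?_ ?_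
  · intro p _ p' _ h
    funext k
    exact Fin.castLE_injective (hsize k) (congrFun h k)
  · intro p _ hp
    obtain ⟨k, hk⟩ : ∃ k, ¬ ((p k : ℕ) < A.size k) := by
      by_contra! hcon
      exact hp ⟨fun k => ⟨p k, hcon k⟩, by simp, rfl⟩
    -- Every level touches some transition: level k is the start of transition k, except the last
    -- level, which ends a transition since D ≥ 1.
    obtain ⟨i, hi⟩ : ∃ i : Fin D,
        ¬ ((p i.castSucc : ℕ) < A.size i.castSucc ∧ (p i.succ : ℕ) < A.size i.succ) := by
      rcases Fin.eq_castSucc_or_eq_last k with ⟨i, rfl⟩ | rfl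
      · exact ⟨i, fun h => hk h.1⟩
      · obtain ⟨d, rfl⟩ := Nat.exists_eq_add_of_le' hD
        exact ⟨Fin.last d, fun h => hk h.2⟩
    rw [Finset.prod_eq_zero (Finset.mem_univ i) (hzero i _ _ hi), mul_zero, zero_mul]
  · intro p _
    have h0 : Fin.castLE (hsize 0) (p 0) = ⟨0, hr⟩ := by
      have := (p 0).2
      have := A.size_zero
      ext
      simp only [Fin.val_castLE]
      omega
    have h1 : Fin.castLE (hsize (Fin.last D)) (p (Fin.last D)) = ⟨0, hr⟩ := by
      have := (p (Fin.last D)).2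
      have := A.size_last
      ext
      simp only [Fin.val_castLE]
      omega
    simp only [h0, h1, Pi.single_eq_same, one_mul, mul_one, hentry]
    split_ifs with hpath
    · rw [map_prod]
      exact Finset.prod_congr rfl fun i _ => (if_pos (hpath i)).symm
    · obtain ⟨i, hi⟩ := not_forall.1 hpath
      exact (Finset.prod_eq_zero (Finset.mem_univ i) (if_neg hi)).symm

end Branching

/-! ### Nonvanishing at a seeded point. -/

section HittingSet

variable {F : Type*} [Field F]

/-- The point with the seeds `α`: block `i`, coordinate `j`. -/
def seedPoint (D n r : ℕ) (c : ℕ → F) (g : F) (α : ℕ → F) (i j : ℕ) : F :=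
  blockPoint c (n * r ^ 2) g α (Nat.clog 2 D + 1) i 0 j

theorem exists_seedPoint_ne_zero {D n r : ℕ} (hD : 1 ≤ D) (hn : 1 ≤ n) (hr : 1 ≤ r) (e : ℕ → F)
    (g : F) (B : ℕ) (hB : D * (n * r ^ 2 * (n * r ^ 2)) ≤ B) (he : Set.InjOn e (Set.Iio B))
    (hg : Set.InjOn (fun a => g ^ a) (Set.Iio (D * (n * r ^ 2 * (n * r ^ 2)))))
    {f : MvPolynomial (Fin D × Fin n) F} (hf : f ∈ setMultilinearABPClass F D n r) (hf0 : f ≠ 0) :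
    ∃ a : ℕ → ℕ, (∀ m, a m < B) ∧ MvPolynomial.eval
      (fun p : Fin D × Fin n => seedPoint D n r e g (fun m => e (a m)) p.1 p.2) f ≠ 0 := by
  obtain ⟨A, hA, rfl⟩ := hf
  have hl : D ≤ 2 ^ (Nat.clog 2 D + 1) :=
    (Nat.le_pow_clog one_lt_two D).trans (Nat.pow_le_pow_right two_pos (Nat.le_succ _))
  have hs : 1 ≤ n * r ^ 2 := Nat.mul_pos hn (pow_pos hr 2)
  have hSB : n * r ^ 2 * (n * r ^ 2) ≤ B := (Nat.le_mul_of_pos_left _ hD).trans hB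
  have hlt : D * (n * r ^ 2 * (n * r ^ 2) - 1) < B := by
    refine lt_of_lt_of_le ?_ hB
    exact Nat.mul_lt_mul_of_pos_left (Nat.sub_lt (Nat.mul_pos hs hs) one_pos) hD
  -- F may be finite. Its algebraic closure is infinite, which yields a nonzero value here and
  -- generic seeds below.
  have hx : ∃ x : Fin D × Fin n → AlgebraicClosure F, MvPolynomial.aeval x A.toPoly ≠ 0 := by
    by_contra! hcon
    refine hf0 (MvPolynomial.map_injective _ (algebraMap F (AlgebraicClosure F)).injective ?_)
    rw [map_zero]
    refine MvPolynomial.funext fun x => ?_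
    rw [MvPolynomial.eval_map, map_zero]
    exact hcon x
  obtain ⟨x, hx⟩ := hx
  have hx' := A.aeval_toPoly hD hr hA hl fun i j =>
    if h : i < D ∧ j < n then x (⟨i, h.1⟩, ⟨j, h.2⟩) else 0
  simp only [Fin.is_lt, and_self, dite_true, Fin.eta] at hx'
  obtain ⟨a, ha, hne⟩ := exists_seeds_ne_zero (K := AlgebraicClosure F) (A.coeffMatrix r) D n (n * r ^ 2) g
    hD hs (Nat.le_mul_of_pos_right n (pow_pos hr 2))
    (by rw [Fintype.card_fin, ← sq]; exact Nat.le_mul_of_pos_left _ hn)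
    (he.mono fun t ht => (Finset.mem_range.1 ht).trans_le hSB) hg e B he hlt (Nat.clog 2 D) _ _ _
    (hx' ▸ hx)
  refine ⟨a, ha, ?_⟩
  rw [nodeValue, ← A.aeval_toPoly hD hr hA hl] at hne
  rwa [← MvPolynomial.coe_aeval_eq_eval]

end HittingSet

/-! ### Elements of large multiplicative order. -/

section LargeOrder

theorem IsFieldEnumeration.injOn {F : Type*} {e : ℕ → F} (he : IsFieldEnumeration e) {B : ℕ}
    (hB : (B : Cardinal) ≤ Cardinal.mk F) : Set.InjOn e (Set.Iio B) := by
  intro a ha b hb hab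
  exact he a b ((Nat.cast_lt.2 ha).trans_le hB) ((Nat.cast_lt.2 hb).trans_le hB) hab

variable {F : Type*} [Field F]

/-- A nonzero element none of whose powers with exponent in `[1, K)` is `1`. -/
def HasLargeOrder (K : ℕ) (x : F) : Prop :=
  x ≠ 0 ∧ ∀ j, 0 < j → j < K → x ^ j ≠ 1

theorem HasLargeOrder.injOn {K : ℕ} {x : F} (h : HasLargeOrder K x) :
    Set.InjOn (fun a => x ^ a) (Set.Iio K) := by
  have key : ∀ a b, a < b → b < K → x ^ a ≠ x ^ b := by
    intro a b hab hb he
    refine h.2 (b - a) (by omega) (by omega) (mul_left_cancel₀ (pow_ne_zero a h.1) ?_)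
    rw [← pow_add, mul_one, he]
    congr 1
    omega
  intro a ha b hb hab
  rcases lt_trichotomy a b with hlt | heq | hlt
  · exact (key a b hlt hb hab).elim
  · exact heq
  · exact (key b a hlt ha hab.symm).elim

/-- One of the first `K * K + 1` elements of the enumeration has large order. -/
theorem IsFieldEnumeration.exists_hasLargeOrder {e : ℕ → F} (he : IsFieldEnumeration e) {K : ℕ}
    (hK : 1 ≤ K) (hcard : ((K + 1 : ℕ) : Cardinal) ≤ Cardinal.mk F) :
    ∃ a < K * K + 1, HasLargeOrder K (e a) := by
  classical
  rcases le_or_gt ((K * K + 1 : ℕ) : Cardinal) (Cardinal.mk F) with hF | hF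
  · by_contra! hcon
    -- The bad elements are 0 and the roots of x^j = 1 for 0 < j < K, at most (K - 1) K + 1 in
    -- total, which is fewer than the K² + 1 distinct elements tested.
    let T : Finset F := insert 0 ((Finset.Ico 1 K).biUnion fun j =>
      (Polynomial.nthRoots j (1 : F)).toFinset)
    have hT : T.card ≤ (K - 1) * K + 1 := by
      refine (Finset.card_insert_le _ _).trans (Nat.add_le_add_right ?_ 1)
      refine (Finset.card_biUnion_le_card_mul _ _ K fun j hj => ?_).trans (by simp)
      exact (Multiset.toFinset_card_le _).trans ((Polynomial.card_nthRoots j 1).trans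
        (Finset.mem_Ico.1 hj).2.le)
    have hmaps : Set.MapsTo e (Finset.range (K * K + 1)) T := by
      intro a ha
      have ha' := hcon a (Finset.mem_range.1 ha)
      rw [HasLargeOrder, not_and_or, not_not] at ha'
      rcases ha' with h0 | h1
      · simp [T, h0]
      · push Not at h1
        obtain ⟨j, hj0, hjK, hj⟩ := h1
        refine Finset.mem_insert_of_mem (Finset.mem_biUnion.2 ⟨j, Finset.mem_Ico.2 ⟨hj0, hjK⟩, ?_⟩)
        rwa [Multiset.mem_toFinset, Polynomial.mem_nthRoots hj0]
    have hle := Finset.card_le_card_of_injOn e hmaps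
      ((he.injOn hF).mono fun a ha => Finset.mem_range.1 ha)
    rw [Finset.card_range] at hle
    have : (K - 1) * K < K * K := Nat.mul_lt_mul_of_pos_right (by omega) hK
    omega
  -- A smaller field is finite and enumerated completely, so the search meets a generator of its
  -- cyclic unit group, whose order |F| - 1 is at least K.
  · have hfin : Finite F := Cardinal.mk_lt_aleph0_iff.1 (hF.trans (Cardinal.natCast_lt_aleph0))
    have := Fintype.ofFinite F
    rw [Cardinal.mk_fintype, Nat.cast_le] at hcard
    rw [Cardinal.mk_fintype, Nat.cast_lt] at hF
    obtain ⟨g, hg⟩ := IsCyclic.exists_generator (α := Fˣ)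
    have hord : orderOf g = Fintype.card F - 1 := by
      rw [orderOf_eq_card_of_forall_mem_zpowers hg, Nat.card_eq_fintype_card, Fintype.card_units]
    have hinj : Function.Injective fun a : Fin (Fintype.card F) => e a := fun a b h =>
      Fin.ext (he.injOn (B := Fintype.card F) (by rw [Cardinal.mk_fintype]) a.2 b.2 h)
    obtain ⟨a, ha⟩ := ((Fintype.bijective_iff_injective_and_card _).2
      ⟨hinj, Fintype.card_fin _⟩).2 (g : F)
    refine ⟨a, a.2.trans hF, ?_⟩
    have ha' : e a = g := ha
    rw [ha']
    refine ⟨g.ne_zero, fun j hj hjK h => ?_⟩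
    have h1 : g ^ j = 1 := Units.ext (by simpa using h)
    exact pow_ne_one_of_lt_orderOf hj.ne' (by omega) h1

end LargeOrder

/-! # Running times from the shape of a program -/

/-- All cells hold numbers of bit length at most `β`. -/
def BitBounded (β : ℕ) (m : ℕ → ℕ) : Prop :=
  ∀ a, (m a).size ≤ β

theorem size_le_self (a : ℕ) : a.size ≤ a :=
  Nat.size_le.2 a.lt_two_pow_self

theorem BitBounded.update {β : ℕ} {m : ℕ → ℕ} (h : BitBounded β m) (c : ℕ) {v : ℕ}
    (hv : v.size ≤ β) : BitBounded β (Function.update m c v) := by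
  intro a
  rcases eq_or_ne a c with rfl | ha
  · simpa using hv
  · simpa [ha] using h a

namespace NatExpr

/-- A factor for the bit length of the value of an expression. -/
def bits : NatExpr → ℕ
  | const c => c.size
  | read _ => 1
  | add a b => a.bits + b.bits + 1
  | sub a _ => a.bits
  | mul a b => a.bits + b.bits
  | div a _ => a.bits
  | mod a _ => a.bits

/-- A factor for the cost of evaluating an expression. -/
def weight : NatExpr → ℕ
  | const c => 1 + c.size
  | read a => a.weight + (1 + a.bits + 1)
  | add a b => a.weight + b.weight + (1 + a.bits + b.bits)
  | sub a b => a.weight + b.weight + (1 + a.bits + b.bits)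
  | mul a b => a.weight + b.weight + (1 + a.bits + b.bits)
  | div a b => a.weight + b.weight + (1 + a.bits + b.bits)
  | mod a b => a.weight + b.weight + (1 + a.bits + b.bits)

/-- Sums and products add bit lengths up to a constant, and a memory read resets the length to at
most β. The factor thus depends only on the syntax. -/
theorem size_val_le {β : ℕ} {m : ℕ → ℕ} (hm : BitBounded β m) (x : NatExpr) :
    (x.val m).size ≤ x.bits * (β + 1) := by
  induction x with
  | const c => exact Nat.le_mul_of_pos_right _ β.succ_pos
  | read a => exact (hm _).trans (by simp [bits])
  | add a b iha ihb =>
    refine Nat.size_le.2 ?_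
    have ha := Nat.size_le.1 iha
    have hb := Nat.size_le.1 ihb
    have h1 : a.val m + b.val m < 2 ^ (a.bits * (β + 1) + b.bits * (β + 1) + 1) := by
      rw [pow_succ, pow_add]
      have := Nat.one_le_two_pow (n := a.bits * (β + 1))
      have := Nat.one_le_two_pow (n := b.bits * (β + 1))
      nlinarith
    refine h1.trans_le (Nat.pow_le_pow_right two_pos ?_)
    rw [bits]
    nlinarith
  | sub a b iha _ => exact (Nat.size_le_size (Nat.sub_le _ _)).trans iha
  | mul a b iha ihb =>
    refine Nat.size_le.2 ?_
    rw [bits, Nat.add_mul, pow_add]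
    exact Nat.mul_lt_mul'' (Nat.size_le.1 iha) (Nat.size_le.1 ihb)
  | div a b iha _ => exact (Nat.size_le_size (Nat.div_le_self _ _)).trans iha
  | mod a b iha _ => exact (Nat.size_le_size (Nat.mod_le _ _)).trans iha

theorem cost_le {β : ℕ} {m : ℕ → ℕ} (hm : BitBounded β m) (x : NatExpr) :
    x.cost m ≤ x.weight * (β + 1) := by
  have hbin : ∀ a b : NatExpr, a.cost m ≤ a.weight * (β + 1) → b.cost m ≤ b.weight * (β + 1) →
      a.cost m + b.cost m + (1 + (a.val m).size + (b.val m).size) ≤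
        (a.weight + b.weight + (1 + a.bits + b.bits)) * (β + 1) := by
    intro a b ha hb
    have := size_val_le hm a
    have := size_val_le hm b
    nlinarith
  induction x with
  | const c => exact Nat.le_mul_of_pos_right _ β.succ_pos
  | read a ih =>
    have h1 := size_val_le hm a
    have h2 := hm (a.val m)
    rw [cost, weight]
    nlinarith
  | add a b iha ihb => exact hbin a b iha ihb
  | sub a b iha ihb => exact hbin a b iha ihb
  | mul a b iha ihb => exact hbin a b iha ihb
  | div a b iha ihb => exact hbin a b iha ihb
  | mod a b iha ihb => exact hbin a b iha ihb

end NatExpr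

namespace FldExpr

/-- A factor for the cost of evaluating an expression. -/
def weight : FldExpr → ℕ
  | zero => 1
  | one => 1
  | elem a => a.weight + 1
  | read a => a.weight + 1
  | add x y => x.weight + y.weight + 1
  | sub x y => x.weight + y.weight + 1
  | mul x y => x.weight + y.weight + 1
  | div x y => x.weight + y.weight + 1

theorem cost_le {β : ℕ} {m : ℕ → ℕ} (hm : BitBounded β m) (x : FldExpr) :
    x.cost m ≤ x.weight * (β + 1) := by
  induction x with
  | zero => simp [cost, weight]
  | one => simp [cost, weight]
  | elem a => have := a.cost_le hm; rw [cost, weight]; nlinarith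
  | read a => have := a.cost_le hm; rw [cost, weight]; nlinarith
  | add x y hx hy => rw [cost, weight]; nlinarith
  | sub x y hx hy => rw [cost, weight]; nlinarith
  | mul x y hx hy => rw [cost, weight]; nlinarith
  | div x y hx hy => rw [cost, weight]; nlinarith

end FldExpr

namespace Test

/-- A factor for the cost of a test. -/
def weight : Test → ℕ
  | natLt a b => a.weight + b.weight + 1
  | natEq a b => a.weight + b.weight + 1
  | fldEq x y => x.weight + y.weight + 1

theorem cost_le {β : ℕ} {m : ℕ → ℕ} (hm : BitBounded β m) (b : Test) :
    b.cost m ≤ b.weight * (β + 1) := by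
  cases b with
  | natLt a b => have := a.cost_le hm; have := b.cost_le hm; rw [cost, weight]; nlinarith
  | natEq a b => have := a.cost_le hm; have := b.cost_le hm; rw [cost, weight]; nlinarith
  | fldEq a b => have := a.cost_le hm; have := b.cost_le hm; rw [cost, weight]; nlinarith

end Test

namespace Program

/-- A factor for the running time of a program. -/
def weight : Program → ℕ
  | skip => 1
  | setNat a b => a.weight + b.weight + 1
  | setFld a x => a.weight + x.weight + 1
  | seq P Q => P.weight + Q.weight
  | branch b P Q => b.weight + 1 + P.weight + Q.weight
  | loop b P => b.weight + 1 + P.weight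

/-- One more than the depth of the nested loops. -/
def rank : Program → ℕ
  | skip => 1
  | setNat _ _ => 1
  | setFld _ _ => 1
  | seq P Q => max P.rank Q.rank
  | branch _ P Q => max P.rank Q.rank
  | loop _ P => P.rank + 1

theorem one_le_rank : ∀ P : Program, 1 ≤ P.rank
  | skip => le_rfl
  | setNat _ _ => le_rfl
  | setFld _ _ => le_rfl
  | seq P _ => P.one_le_rank.trans (le_max_left _ _)
  | branch _ P _ => P.one_le_rank.trans (le_max_left _ _)
  | loop _ _ => Nat.le_add_left _ _

end Program

section Exec

variable {F : Type*} [Field F]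

/-- The program transforms the memory as indicated, within the time that its shape suggests when all
numbers have bit length at most `β` and all loops make at most `β` iterations. -/
def Exec (e : ℕ → F) (β : ℕ) (P : Program) (m : ℕ → ℕ) (φ : ℕ → F) (m' : ℕ → ℕ) (φ' : ℕ → F) :
    Prop :=
  ∃ t ≤ P.weight * (β + 1) ^ P.rank, Runs e P ⟨m, φ⟩ ⟨m', φ'⟩ t

variable {e : ℕ → F} {β : ℕ} {m m' m'' : ℕ → ℕ} {φ φ' φ'' : ℕ → F}

theorem Exec.skip : Exec e β Program.skip m φ m φ :=
  ⟨1, by simp [Program.weight, Program.rank], Runs.skip _⟩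

theorem Exec.setNat (hm : BitBounded β m) (a b : NatExpr) :
    Exec e β (Program.setNat a b) m φ (Function.update m (a.val m) (b.val m)) φ := by
  refine ⟨_, ?_, Runs.setNat a b ⟨m, φ⟩⟩
  have := a.cost_le hm
  have := b.cost_le hm
  rw [Program.weight, Program.rank]
  nlinarith

theorem Exec.setFld (hm : BitBounded β m) (a : NatExpr) (x : FldExpr) :
    Exec e β (Program.setFld a x) m φ m (Function.update φ (a.val m) (x.val e ⟨m, φ⟩)) := by
  refine ⟨_, ?_, Runs.setFld a x ⟨m, φ⟩⟩
  have := a.cost_le hm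
  have := x.cost_le hm
  rw [Program.weight, Program.rank]
  simp only
  nlinarith

theorem Exec.seq {P Q : Program} (hP : Exec e β P m φ m' φ') (hQ : Exec e β Q m' φ' m'' φ'') :
    Exec e β (Program.seq P Q) m φ m'' φ'' := by
  obtain ⟨t, ht, hP⟩ := hP
  obtain ⟨t', ht', hQ⟩ := hQ
  refine ⟨t + t', ?_, Runs.seq hP hQ⟩
  rw [Program.weight, Program.rank, Nat.add_mul]
  exact Nat.add_le_add
    (ht.trans (Nat.mul_le_mul_left _ (Nat.pow_le_pow_right β.succ_pos (le_max_left _ _))))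
    (ht'.trans (Nat.mul_le_mul_left _ (Nat.pow_le_pow_right β.succ_pos (le_max_right _ _))))

theorem Exec.branch (hm : BitBounded β m) {b : Test} {P Q : Program}
    (hP : b.Holds e ⟨m, φ⟩ → Exec e β P m φ m' φ')
    (hQ : ¬ b.Holds e ⟨m, φ⟩ → Exec e β Q m φ m' φ') :
    Exec e β (Program.branch b P Q) m φ m' φ' := by
  have hb := b.cost_le hm
  have hbP : (b.weight + 1) * (β + 1) ≤ (b.weight + 1) * (β + 1) ^ max P.rank Q.rank :=
    Nat.mul_le_mul_left _
      (Nat.le_self_pow (by have := P.one_le_rank; omega) _)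
  have hwP : P.weight * (β + 1) ^ P.rank ≤ P.weight * (β + 1) ^ max P.rank Q.rank :=
    Nat.mul_le_mul_left _ (Nat.pow_le_pow_right β.succ_pos (le_max_left _ _))
  have hwQ : Q.weight * (β + 1) ^ Q.rank ≤ Q.weight * (β + 1) ^ max P.rank Q.rank :=
    Nat.mul_le_mul_left _ (Nat.pow_le_pow_right β.succ_pos (le_max_right _ _))
  have h1 : (b.weight + 1) * (β + 1) = b.weight * (β + 1) + (β + 1) := by ring
  by_cases h : b.Holds e ⟨m, φ⟩
  · obtain ⟨t, ht, hP⟩ := hP h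
    refine ⟨_, ?_, Runs.branch_true h hP⟩
    simp only [Program.weight, Program.rank, Nat.add_mul _ P.weight, Nat.add_mul _ Q.weight]
    omega
  · obtain ⟨t, ht, hQ⟩ := hQ h
    refine ⟨_, ?_, Runs.branch_false h hQ⟩
    simp only [Program.weight, Program.rank, Nat.add_mul _ P.weight, Nat.add_mul _ Q.weight]
    omega

/-- The natural number cells follow a prescribed course M, and the field cells only satisfy an
invariant I. At most β rounds and one failing test account for one more factor β + 1, hence for the
increase of the rank. -/
theorem Exec.loop {b : Test} {P : Program} (N : ℕ) (hN : N ≤ β) (M : ℕ → ℕ → ℕ)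
    (hM : ∀ i ≤ N, BitBounded β (M i)) (I : ℕ → (ℕ → F) → Prop)
    (hb : ∀ i < N, ∀ φ, b.Holds e ⟨M i, φ⟩) (hbN : ∀ φ, ¬ b.Holds e ⟨M N, φ⟩)
    (hP : ∀ i < N, ∀ φ, I i φ → ∃ φ', Exec e β P (M i) φ (M (i + 1)) φ' ∧ I (i + 1) φ')
    (φ : ℕ → F) (hI : I 0 φ) :
    ∃ φ', Exec e β (Program.loop b P) (M 0) φ (M N) φ' ∧ I N φ' := by
  have key : ∀ d i, i + d = N → ∀ φ, I i φ → ∃ φ', I N φ' ∧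
      ∃ t ≤ d * ((b.weight + 1) * (β + 1) + P.weight * (β + 1) ^ P.rank) +
        (b.weight + 1) * (β + 1), Runs e (Program.loop b P) ⟨M i, φ⟩ ⟨M N, φ'⟩ t := by
    intro d
    induction d with
    | zero =>
      rintro i rfl φ hφ
      refine ⟨φ, hφ, _, ?_, Runs.loop_stop (hbN φ)⟩
      have := b.cost_le (hM i le_rfl)
      simp only
      nlinarith
    | succ d ih =>
      intro i hi φ hφ
      have hiN : i < N := by omega
      obtain ⟨φ₁, ⟨t, ht, hrun⟩, hI₁⟩ := hP i hiN φ hφ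
      obtain ⟨φ₂, hI₂, t', ht', hrun'⟩ := ih (i + 1) (by omega) φ₁ hI₁
      refine ⟨φ₂, hI₂, _, ?_, Runs.loop_step (hb i hiN φ) hrun hrun'⟩
      have := b.cost_le (hM i hiN.le)
      simp only
      nlinarith
  obtain ⟨φ', hI', t, ht, hrun⟩ := key N 0 (zero_add N) φ hI
  refine ⟨φ', ⟨t, ht.trans ?_, hrun⟩, hI'⟩
  rw [Program.weight, Program.rank, pow_succ]
  have h1 : (β + 1) ≤ (β + 1) ^ P.rank :=
    Nat.le_self_pow (by have := P.one_le_rank; omega) _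
  generalize (β + 1) ^ P.rank = Y at h1 ⊢
  calc N * ((b.weight + 1) * (β + 1) + P.weight * Y) + (b.weight + 1) * (β + 1)
      ≤ β * ((b.weight + 1) * Y + P.weight * Y) + ((b.weight + 1) * Y + P.weight * Y) := by
        gcongr
        exact (Nat.mul_le_mul_left _ h1).trans (Nat.le_add_right _ _)
    _ = (b.weight + 1 + P.weight) * (Y * (β + 1)) := by ring

/-- The cell with address `c`. -/
abbrev NatExpr.cell (c : ℕ) : NatExpr :=
  NatExpr.read (NatExpr.const c)

/-- Run `P` with the values `0, 1, …` below `b` in the cell `c`, then put `0` into this cell. -/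
def Program.forLoop (c : ℕ) (b : NatExpr) (P : Program) : Program :=
  Program.seq
    (Program.loop (Test.natLt (NatExpr.cell c) b)
      (Program.seq P
        (Program.setNat (NatExpr.const c) (NatExpr.add (NatExpr.cell c) (NatExpr.const 1)))))
    (Program.setNat (NatExpr.const c) (NatExpr.const 0))

/-- Resetting the counter restores the natural number memory exactly, so that loops nest and only
field cells need an invariant. -/
theorem Exec.forLoop {c : ℕ} {b : NatExpr} {P : Program} (N : ℕ) (hN : N ≤ β)
    (hm : BitBounded β m) (hc : m c = 0) (hb : ∀ i, b.val (Function.update m c i) = N)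
    (I : ℕ → (ℕ → F) → Prop)
    (hP : ∀ i < N, ∀ φ, I i φ → BitBounded β (Function.update m c i) →
      ∃ φ', Exec e β P (Function.update m c i) φ (Function.update m c i) φ' ∧ I (i + 1) φ')
    (φ : ℕ → F) (hI : I 0 φ) :
    ∃ φ', Exec e β (Program.forLoop c b P) m φ m φ' ∧ I N φ' := by
  have hM : ∀ i ≤ N, BitBounded β (Function.update m c i) := fun i hi =>
    hm.update c ((size_le_self i).trans (hi.trans hN))
  obtain ⟨φ', hrun, hI'⟩ := Exec.loop (e := e) (b := Test.natLt (NatExpr.cell c) b)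
    (P := Program.seq P
      (Program.setNat (NatExpr.const c) (NatExpr.add (NatExpr.cell c) (NatExpr.const 1))))
    N hN (fun i => Function.update m c i) hM I
    (fun i hi φ => by simpa [Test.Holds, NatExpr.val, hb] using hi)
    (fun φ => by simp [Test.Holds, NatExpr.val, hb])
    (fun i hi φ hφ => by
      obtain ⟨φ', hrun, hI'⟩ := hP i hi φ hφ (hM i hi.le)
      refine ⟨φ', hrun.seq ?_, hI'⟩
      simpa [NatExpr.val] using Exec.setNat (e := e) (φ := φ') (hM i hi.le) (NatExpr.const c)
        (NatExpr.add (NatExpr.cell c) (NatExpr.const 1))) φ hI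
  have h0 : Function.update m c 0 = m := Function.update_eq_self_iff.2 hc.symm
  refine ⟨φ', Exec.seq (m' := Function.update m c N) (φ' := φ') ?_ ?_, hI'⟩
  · simpa [h0] using hrun
  · simpa [NatExpr.val, h0] using
      Exec.setNat (e := e) (φ := φ') (hM N le_rfl) (NatExpr.const c) (NatExpr.const 0)

end Exec

/-! # The program

The cells for natural numbers: `0, 1, 2, 3` hold the input `D, n, r, k`; `4, …, 8` are loop
counters; `9, 10, 11` hold `2 ^ l`, `k / B ^ l` and `i / 2 ^ l` on level `l`.

The cells for field elements: after the `D * n` output cells there are cells for the element of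
large order, a product, a sum and the parameter of a curve; then the values of the points of the
current and of the next level alternate. -/

open NatExpr Program

/-- `n * r ^ 2` -/
def pointsExpr : NatExpr := mul (cell 1) (mul (cell 2) (cell 2))

/-- the square of `n * r ^ 2` -/
def nodesExpr : NatExpr := mul pointsExpr pointsExpr

/-- `D * (n * r ^ 2) ^ 2` -/
def orderExpr : NatExpr := mul (cell 0) nodesExpr

/-- `2 * D * (n * r ^ 2) ^ 2` -/
def radixExpr : NatExpr := mul (const 2) orderExpr

/-- the address of the `a`-th auxiliary field cell -/
def scratch (a : ℕ) : NatExpr := add (mul (cell 0) (cell 1)) (const a)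

/-- the address of the `x`-th entry of an array that starts at the `a`-th auxiliary field cell -/
def entry (a : ℕ) (x : NatExpr) : NatExpr := add (scratch a) (mul (const 2) x)

/-- the index of the point of the previous level -/
def childExpr : NatExpr :=
  add (mul (sub (const 1) (mod (cell 11) (const 2))) (div (cell 7) pointsExpr))
    (mul (mod (cell 11) (const 2)) (mod (cell 7) pointsExpr))

/-- The input cells. -/
structure ParamCells (m : ℕ → ℕ) (D n r k : ℕ) : Prop where
  zero : m 0 = D
  one : m 1 = n
  two : m 2 = r
  three : m 3 = k

namespace ParamCells

variable {m : ℕ → ℕ} {D n r k : ℕ}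

theorem update (h : ParamCells m D n r k) {c : ℕ} (hc : 4 ≤ c) (v : ℕ) :
    ParamCells (Function.update m c v) D n r k := by
  constructor
  · rw [Function.update_of_ne (by omega), h.zero]
  · rw [Function.update_of_ne (by omega), h.one]
  · rw [Function.update_of_ne (by omega), h.two]
  · rw [Function.update_of_ne (by omega), h.three]

theorem val_points (h : ParamCells m D n r k) : pointsExpr.val m = n * r ^ 2 := by
  simp [pointsExpr, NatExpr.val, h.one, h.two, sq]

theorem val_nodes (h : ParamCells m D n r k) :
    nodesExpr.val m = n * r ^ 2 * (n * r ^ 2) := by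
  simp [nodesExpr, NatExpr.val, h.val_points]

theorem val_order (h : ParamCells m D n r k) :
    orderExpr.val m = D * (n * r ^ 2 * (n * r ^ 2)) := by
  simp [orderExpr, NatExpr.val, h.val_nodes, h.zero]

theorem val_radix (h : ParamCells m D n r k) :
    radixExpr.val m = 2 * (D * (n * r ^ 2 * (n * r ^ 2))) := by
  simp [radixExpr, NatExpr.val, h.val_order]

theorem val_scratch (h : ParamCells m D n r k) (a : ℕ) : (scratch a).val m = D * n + a := by
  simp [scratch, NatExpr.val, h.zero, h.one]

theorem val_entry (h : ParamCells m D n r k) (a : ℕ) (x : NatExpr) :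
    (entry a x).val m = D * n + a + 2 * x.val m := by
  simp [entry, NatExpr.val, h.val_scratch]

/-- The parity bit weights the two summands by 0 and 1, an arithmetic replacement for branching. -/
theorem val_child (h : ParamCells m D n r k) : childExpr.val m =
    if m 11 % 2 = 0 then m 7 / (n * r ^ 2) else m 7 % (n * r ^ 2) := by
  rcases Nat.mod_two_eq_zero_or_one (m 11) with h0 | h1
  · simp [childExpr, NatExpr.val, h.val_points, h0]
  · simp [childExpr, NatExpr.val, h.val_points, h1]

end ParamCells

/-- Multiply the product cell by the value of a polynomial of the Lagrange basis. -/
def lagrangeProgram : Program :=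
  seq (setFld (scratch 1) FldExpr.one) <| forLoop 8 nodesExpr <|
    branch (Test.natEq (cell 8) (cell 7)) skip <|
      setFld (scratch 1) (FldExpr.mul (FldExpr.read (scratch 1))
        (FldExpr.div (FldExpr.sub (FldExpr.read (scratch 3)) (FldExpr.elem (cell 8)))
          (FldExpr.sub (FldExpr.elem (cell 7)) (FldExpr.elem (cell 8)))))

/-- Evaluate a curve. -/
def curveProgram : Program :=
  seq (setFld (scratch 2) FldExpr.zero) <| forLoop 7 nodesExpr <|
    seq lagrangeProgram <|
      setFld (scratch 2) (FldExpr.add (FldExpr.read (scratch 2))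
        (FldExpr.mul (FldExpr.read (scratch 1)) (FldExpr.read (entry 4 childExpr))))

/-- Compute the points of the next level. -/
def stepProgram : Program :=
  forLoop 6 pointsExpr <|
    seq curveProgram <| seq (setFld (entry 5 (cell 6)) (FldExpr.read (scratch 2))) <|
      setFld (scratch 3) (FldExpr.mul (FldExpr.read (scratch 0)) (FldExpr.read (scratch 3)))

/-- The points of the next level become those of the current one. -/
def copyProgram : Program :=
  forLoop 6 pointsExpr <| setFld (entry 4 (cell 6)) (FldExpr.read (entry 5 (cell 6)))

/-- Pass to the next level. -/
def levelProgram : Program :=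
  seq (setFld (scratch 3) (FldExpr.elem (mod (cell 10) radixExpr))) <| seq stepProgram <|
    seq copyProgram <| seq (setNat (const 9) (mul (const 2) (cell 9))) <|
      seq (setNat (const 10) (div (cell 10) radixExpr)) <|
        setNat (const 11) (div (cell 11) (const 2))

/-- The points of level `0`. -/
def initProgram : Program :=
  forLoop 6 pointsExpr <| branch (Test.natEq (cell 6) (cell 5))
    (setFld (entry 4 (cell 6)) FldExpr.one) (setFld (entry 4 (cell 6)) FldExpr.zero)

/-- Compute one coordinate of the output. -/
def coordProgram : Program :=
  seq initProgram <| seq (setNat (const 9) (const 1)) <| seq (setNat (const 10) (cell 3)) <|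
    seq (setNat (const 11) (cell 4)) <|
      seq (loop (Test.natLt (cell 9) (mul (const 2) (cell 0))) levelProgram) <|
        seq (setFld (add (mul (cell 1) (cell 4)) (cell 5)) (FldExpr.read (scratch 4))) <|
          seq (setNat (const 9) (const 0)) <| seq (setNat (const 10) (const 0)) <|
            setNat (const 11) (const 0)

/-- Put an element of large order into the zeroth auxiliary cell. -/
def orderProgram : Program :=
  forLoop 4 (add (mul orderExpr orderExpr) (const 1)) <|
    branch (Test.fldEq (FldExpr.elem (cell 4)) FldExpr.zero) skip <|
      seq (setFld (scratch 1) FldExpr.one) <| seq (setFld (scratch 2) FldExpr.one) <|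
        seq (forLoop 5 (sub orderExpr (const 1)) <|
          seq (setFld (scratch 1) (FldExpr.mul (FldExpr.read (scratch 1))
            (FldExpr.elem (cell 4)))) <|
          branch (Test.fldEq (FldExpr.read (scratch 1)) FldExpr.one)
            (setFld (scratch 2) FldExpr.zero) skip) <|
        branch (Test.fldEq (FldExpr.read (scratch 2)) FldExpr.one)
          (setFld (scratch 0) (FldExpr.elem (cell 4))) skip

/-- The program that computes the points of the hitting set. -/
def hittingProgram : Program :=
  seq orderProgram <| forLoop 4 (cell 0) <| forLoop 5 (cell 1) coordProgram

/-! ### Correctness of the subroutines. -/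

section Spec

variable {F : Type*} [Field F] {e : ℕ → F} {β D n r k : ℕ} {m : ℕ → ℕ}

/-- This is the product the program forms. It needs no distinct nodes: for coinciding ones both
sides follow the convention that division by zero gives 0. -/
theorem aeval_basis_eq_prod (S t : ℕ) (z : F) :
    Polynomial.aeval z (Lagrange.basis (Finset.range S) e t) =
      ∏ u ∈ Finset.range S, if u = t then 1 else (z - e u) / (e t - e u) := by
  rw [Lagrange.basis, map_prod, ← Finset.filter_ne', Finset.prod_filter]
  refine Finset.prod_congr rfl fun u _ => ?_
  by_cases h : u = t
  · simp [h]
  · simp [h, Lagrange.basisDivisor, div_eq_inv_mul]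

theorem exec_lagrangeProgram (hm : BitBounded β m) (h : ParamCells m D n r k) (h8 : m 8 = 0)
    (hS : n * r ^ 2 * (n * r ^ 2) ≤ β) (φ : ℕ → F) :
    ∃ φ', Exec e β lagrangeProgram m φ m φ' ∧ φ' (D * n + 1) = Polynomial.aeval (φ (D * n + 3))
        (Lagrange.basis (Finset.range (n * r ^ 2 * (n * r ^ 2))) e (m 7)) ∧
      ∀ a, a ≠ D * n + 1 → φ' a = φ a := by
  have hrun₀ := Exec.setFld (e := e) (φ := φ) hm (scratch 1) FldExpr.one
  rw [h.val_scratch] at hrun₀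
  obtain ⟨φ', hrun, hI, hframe⟩ := Exec.forLoop (e := e) (c := 8) (b := nodesExpr)
    (P := branch (Test.natEq (cell 8) (cell 7)) skip <|
      setFld (scratch 1) (FldExpr.mul (FldExpr.read (scratch 1))
        (FldExpr.div (FldExpr.sub (FldExpr.read (scratch 3)) (FldExpr.elem (cell 8)))
          (FldExpr.sub (FldExpr.elem (cell 7)) (FldExpr.elem (cell 8))))))
    _ hS hm h8 (fun i => (h.update (by norm_num) i).val_nodes)
    (fun U ψ => ψ (D * n + 1) = (∏ u ∈ Finset.range U, if u = m 7 then 1 else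
      (φ (D * n + 3) - e u) / (e (m 7) - e u)) ∧ ∀ a, a ≠ D * n + 1 → ψ a = φ a)
    (fun u _ ψ hψ hmu => by
      obtain ⟨hψ1, hψ2⟩ := hψ
      have hu := h.update (c := 8) (by norm_num) u
      by_cases hut : u = m 7
      · refine ⟨ψ, Exec.branch hmu (fun _ => Exec.skip) (fun hne => (hne ?_).elim), ?_, hψ2⟩
        · simpa [Test.Holds, NatExpr.val] using hut
        · rw [Finset.prod_range_succ, if_pos hut, mul_one, hψ1]
      · refine ⟨_, Exec.branch hmu (fun hne => (hut ?_).elim) (fun _ => Exec.setFld hmu _ _), ?_, ?_⟩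
        · simpa [Test.Holds, NatExpr.val] using hne
        · rw [hu.val_scratch, Function.update_self, Finset.prod_range_succ, if_neg hut, ← hψ1]
          simp [FldExpr.val, NatExpr.val, hu.val_scratch, hψ2 (D * n + 3)]
        · intro a ha
          rw [hu.val_scratch, Function.update_of_ne ha, hψ2 a ha])
    (Function.update φ (D * n + 1) 1) ⟨by simp, fun a ha => Function.update_of_ne ha _ _⟩
  exact ⟨φ', hrun₀.seq hrun, by rw [hI, aeval_basis_eq_prod], hframe⟩

theorem exec_curveProgram (hm : BitBounded β m) (h : ParamCells m D n r k) (h7 : m 7 = 0)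
    (h8 : m 8 = 0) (hS : n * r ^ 2 * (n * r ^ 2) ≤ β) (φ : ℕ → F) :
    ∃ φ', Exec e β curveProgram m φ m φ' ∧
      φ' (D * n + 2) = ∑ t ∈ Finset.range (n * r ^ 2 * (n * r ^ 2)),
        Polynomial.aeval (φ (D * n + 3))
          (Lagrange.basis (Finset.range (n * r ^ 2 * (n * r ^ 2))) e t) *
          φ (D * n + 4 + 2 * if m 11 % 2 = 0 then t / (n * r ^ 2) else t % (n * r ^ 2)) ∧
      ∀ a, a ≠ D * n + 1 → a ≠ D * n + 2 → φ' a = φ a := by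
  have hrun₀ := Exec.setFld (e := e) (φ := φ) hm (scratch 2) FldExpr.zero
  rw [h.val_scratch] at hrun₀
  obtain ⟨φ', hrun, hI, hframe⟩ := Exec.forLoop (e := e) (c := 7) (b := nodesExpr)
    (P := seq lagrangeProgram <|
      setFld (scratch 2) (FldExpr.add (FldExpr.read (scratch 2))
        (FldExpr.mul (FldExpr.read (scratch 1)) (FldExpr.read (entry 4 childExpr)))))
    _ hS hm h7 (fun i => (h.update (by norm_num) i).val_nodes)
    (fun T ψ => ψ (D * n + 2) = (∑ t ∈ Finset.range T, Polynomial.aeval (φ (D * n + 3))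
      (Lagrange.basis (Finset.range (n * r ^ 2 * (n * r ^ 2))) e t) *
        φ (D * n + 4 + 2 * if m 11 % 2 = 0 then t / (n * r ^ 2) else t % (n * r ^ 2))) ∧
      ∀ a, a ≠ D * n + 1 → a ≠ D * n + 2 → ψ a = φ a)
    (fun t _ ψ hψ hmt => by
      obtain ⟨hψ1, hψ2⟩ := hψ
      have ht := h.update (c := 7) (by norm_num) t
      obtain ⟨ψ', hrun', hψ', hframe'⟩ := exec_lagrangeProgram (e := e) hmt ht (by simpa using h8)
        hS ψ
      refine ⟨_, hrun'.seq (Exec.setFld hmt _ _), ?_, ?_⟩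
      · rw [ht.val_scratch, Function.update_self, Finset.sum_range_succ, ← hψ1]
        have h11 : Function.update m 7 t 11 = m 11 := by simp
        simp only [FldExpr.val, ht.val_scratch, ht.val_entry, ht.val_child, hψ', h11,
          Function.update_self]
        generalize (if m 11 % 2 = 0 then t / (n * r ^ 2) else t % (n * r ^ 2)) = x
        rw [hframe' (D * n + 2) (by omega), hframe' (D * n + 4 + 2 * x) (by omega),
          hψ2 (D * n + 3) (by omega) (by omega),
          hψ2 (D * n + 4 + 2 * x) (by omega) (by omega)]
      · intro a ha1 ha2
        rw [ht.val_scratch, Function.update_of_ne ha2, hframe' a ha1, hψ2 a ha1 ha2])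
    (Function.update φ (D * n + 2) 0) ⟨by simp, fun a _ ha => Function.update_of_ne ha _ _⟩
  exact ⟨φ', hrun₀.seq hrun, hI, hframe⟩

/-- New values go to the odd offsets 5 + 2x while the old ones at 4 + 2x stay readable. The
parameter cell is multiplied by g after each point, hence holds g^x α. -/
theorem exec_stepProgram (hm : BitBounded β m) (h : ParamCells m D n r k) (h6 : m 6 = 0)
    (h7 : m 7 = 0) (h8 : m 8 = 0) (hs : n * r ^ 2 ≤ β) (hS : n * r ^ 2 * (n * r ^ 2) ≤ β)
    (φ : ℕ → F) :
    ∃ φ', Exec e β stepProgram m φ m φ' ∧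
      (∀ x < n * r ^ 2, φ' (D * n + 5 + 2 * x) =
        ∑ t ∈ Finset.range (n * r ^ 2 * (n * r ^ 2)),
          Polynomial.aeval (φ (D * n) ^ x * φ (D * n + 3))
            (Lagrange.basis (Finset.range (n * r ^ 2 * (n * r ^ 2))) e t) *
          φ (D * n + 4 + 2 * if m 11 % 2 = 0 then t / (n * r ^ 2) else t % (n * r ^ 2))) ∧
      ∀ a ≤ D * n, φ' a = φ a := by
  obtain ⟨φ', hrun, h3, hI, h4, hframe⟩ := Exec.forLoop (e := e) (c := 6) (b := pointsExpr)
    (P := seq curveProgram <| seq (setFld (entry 5 (cell 6)) (FldExpr.read (scratch 2))) <|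
      setFld (scratch 3) (FldExpr.mul (FldExpr.read (scratch 0)) (FldExpr.read (scratch 3))))
    _ hs hm h6 (fun i => (h.update (by norm_num) i).val_points)
    (fun y ψ => ψ (D * n + 3) = φ (D * n) ^ y * φ (D * n + 3) ∧
      (∀ x < y, ψ (D * n + 5 + 2 * x) =
        ∑ t ∈ Finset.range (n * r ^ 2 * (n * r ^ 2)),
          Polynomial.aeval (φ (D * n) ^ x * φ (D * n + 3))
            (Lagrange.basis (Finset.range (n * r ^ 2 * (n * r ^ 2))) e t) *
          φ (D * n + 4 + 2 * if m 11 % 2 = 0 then t / (n * r ^ 2) else t % (n * r ^ 2))) ∧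
      (∀ x, ψ (D * n + 4 + 2 * x) = φ (D * n + 4 + 2 * x)) ∧ ∀ a ≤ D * n, ψ a = φ a)
    (fun y _ ψ hψ hmy => by
      obtain ⟨hψ3, hψI, hψ4, hψf⟩ := hψ
      have hy := h.update (c := 6) (by norm_num) y
      obtain ⟨ψ', hrun', hψ', hframe'⟩ := exec_curveProgram (e := e) hmy hy (by simpa using h7)
        (by simpa using h8) hS ψ
      have hcell : (cell 6).val (Function.update m 6 y) = y := by simp [NatExpr.val]
      refine ⟨_, hrun'.seq ((Exec.setFld hmy _ _).seq (Exec.setFld hmy _ _)), ?_, ?_, ?_, ?_⟩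
      · simp only [FldExpr.val, hy.val_scratch, hy.val_entry, hcell, add_zero]
        rw [Function.update_self, Function.update_of_ne (by omega),
          Function.update_of_ne (by omega), hframe' _ (by omega) (by omega),
          hframe' _ (by omega) (by omega), hψ3, hψf _ le_rfl, pow_succ', mul_assoc]
      · intro x hx
        simp only [FldExpr.val, hy.val_scratch, hy.val_entry, hcell, add_zero]
        rw [Function.update_of_ne (by omega)]
        rcases Nat.lt_succ_iff_lt_or_eq.1 hx with hx | rfl
        · rw [Function.update_of_ne (by omega), hframe' _ (by omega) (by omega), hψI x hx]
        · have h11 : Function.update m 6 x 11 = m 11 := by simp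
          simp only [Function.update_self, hψ', hψ3, hψ4, h11]
      · intro x
        simp only [FldExpr.val, hy.val_scratch, hy.val_entry, hcell, add_zero]
        rw [Function.update_of_ne (by omega), Function.update_of_ne (by omega),
          hframe' _ (by omega) (by omega), hψ4]
      · intro a ha
        simp only [FldExpr.val, hy.val_scratch, hy.val_entry, hcell, add_zero]
        rw [Function.update_of_ne (by omega), Function.update_of_ne (by omega),
          hframe' _ (by omega) (by omega), hψf a ha])
    φ ⟨by simp, by simp, by simp, by simp⟩
  exact ⟨φ', hrun, hI, hframe⟩

theorem exec_copyProgram (hm : BitBounded β m) (h : ParamCells m D n r k) (h6 : m 6 = 0)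
    (hs : n * r ^ 2 ≤ β) (φ : ℕ → F) :
    ∃ φ', Exec e β copyProgram m φ m φ' ∧
      (∀ x < n * r ^ 2, φ' (D * n + 4 + 2 * x) = φ (D * n + 5 + 2 * x)) ∧
      ∀ a ≤ D * n, φ' a = φ a := by
  obtain ⟨φ', hrun, hI, h5, hframe⟩ := Exec.forLoop (e := e) (c := 6) (b := pointsExpr)
    (P := setFld (entry 4 (cell 6)) (FldExpr.read (entry 5 (cell 6))))
    _ hs hm h6 (fun i => (h.update (by norm_num) i).val_points)
    (fun y ψ => (∀ x < y, ψ (D * n + 4 + 2 * x) = φ (D * n + 5 + 2 * x)) ∧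
      (∀ x, ψ (D * n + 5 + 2 * x) = φ (D * n + 5 + 2 * x)) ∧ ∀ a ≤ D * n, ψ a = φ a)
    (fun y _ ψ hψ hmy => by
      obtain ⟨hψ4, hψ5, hψf⟩ := hψ
      have hy := h.update (c := 6) (by norm_num) y
      have hcell : (cell 6).val (Function.update m 6 y) = y := by simp [NatExpr.val]
      refine ⟨_, Exec.setFld hmy _ _, ?_, ?_, ?_⟩
      · intro x hx
        simp only [FldExpr.val, hy.val_entry, hcell]
        rcases Nat.lt_succ_iff_lt_or_eq.1 hx with hx | rfl
        · rw [Function.update_of_ne (by omega), hψ4 x hx]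
        · rw [Function.update_self, hψ5]
      · intro x
        simp only [FldExpr.val, hy.val_entry, hcell]
        rw [Function.update_of_ne (by omega), hψ5]
      · intro a ha
        simp only [FldExpr.val, hy.val_entry, hcell]
        rw [Function.update_of_ne (by omega), hψf a ha])
    φ ⟨by simp, by simp, by simp⟩
  exact ⟨φ', hrun, hI, hframe⟩

theorem exec_initProgram (hm : BitBounded β m) (h : ParamCells m D n r k) (h6 : m 6 = 0)
    (hs : n * r ^ 2 ≤ β) (φ : ℕ → F) :
    ∃ φ', Exec e β initProgram m φ m φ' ∧
      (∀ x < n * r ^ 2, φ' (D * n + 4 + 2 * x) = if x = m 5 then 1 else 0) ∧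
      ∀ a ≤ D * n, φ' a = φ a := by
  obtain ⟨φ', hrun, hI, hframe⟩ := Exec.forLoop (e := e) (c := 6) (b := pointsExpr)
    (P := branch (Test.natEq (cell 6) (cell 5))
      (setFld (entry 4 (cell 6)) FldExpr.one) (setFld (entry 4 (cell 6)) FldExpr.zero))
    _ hs hm h6 (fun i => (h.update (by norm_num) i).val_points)
    (fun y ψ => (∀ x < y, ψ (D * n + 4 + 2 * x) = if x = m 5 then 1 else 0) ∧
      ∀ a ≤ D * n, ψ a = φ a)
    (fun y _ ψ hψ hmy => by
      obtain ⟨hψ4, hψf⟩ := hψ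
      have hy := h.update (c := 6) (by norm_num) y
      have hcell : (cell 6).val (Function.update m 6 y) = y := by simp [NatExpr.val]
      refine ⟨Function.update ψ (D * n + 4 + 2 * y) (if y = m 5 then 1 else 0),
        Exec.branch hmy (fun hb => ?_) (fun hb => ?_), ?_, ?_⟩
      · have hb' : y = m 5 := by simpa [Test.Holds, NatExpr.val] using hb
        have := Exec.setFld (e := e) (φ := ψ) hmy (entry 4 (cell 6)) FldExpr.one
        rwa [hy.val_entry, hcell, FldExpr.val, ← if_pos (c := y = m 5) hb' (t := (1 : F))
          (e := 0)] at this
      · have hb' : ¬ y = m 5 := by simpa [Test.Holds, NatExpr.val] using hb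
        have := Exec.setFld (e := e) (φ := ψ) hmy (entry 4 (cell 6)) FldExpr.zero
        rwa [hy.val_entry, hcell, FldExpr.val, ← if_neg (c := y = m 5) hb' (t := (1 : F))
          (e := 0)] at this
      · intro x hx
        rcases Nat.lt_succ_iff_lt_or_eq.1 hx with hx | rfl
        · rw [Function.update_of_ne (by omega), hψ4 x hx]
        · rw [Function.update_self]
      · intro a ha
        rw [Function.update_of_ne (by omega), hψf a ha])
    φ ⟨by simp, by simp⟩
  exact ⟨φ', hrun, hI, hframe⟩

end Spec

/-! ### One level, and one output coordinate. -/

section LevelSpec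

variable {F : Type*} [Field F] {e : ℕ → F} {β D n r k : ℕ} {m : ℕ → ℕ}

theorem exec_levelProgram (hm : BitBounded β m) (h : ParamCells m D n r k) (h6 : m 6 = 0)
    (h7 : m 7 = 0) (h8 : m 8 = 0) (hs : n * r ^ 2 ≤ β) (hS : n * r ^ 2 * (n * r ^ 2) ≤ β)
    (h9 : (2 * m 9).size ≤ β) (φ : ℕ → F) :
    ∃ φ', Exec e β levelProgram m φ
      (Function.update (Function.update (Function.update m 9 (2 * m 9)) 10
        (m 10 / (2 * (D * (n * r ^ 2 * (n * r ^ 2)))))) 11 (m 11 / 2)) φ' ∧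
      (∀ x < n * r ^ 2, φ' (D * n + 4 + 2 * x) =
        ∑ t ∈ Finset.range (n * r ^ 2 * (n * r ^ 2)),
          Polynomial.aeval
            (φ (D * n) ^ x * e (m 10 % (2 * (D * (n * r ^ 2 * (n * r ^ 2))))))
            (Lagrange.basis (Finset.range (n * r ^ 2 * (n * r ^ 2))) e t) *
          φ (D * n + 4 + 2 * if m 11 % 2 = 0 then t / (n * r ^ 2) else t % (n * r ^ 2))) ∧
      ∀ a ≤ D * n, φ' a = φ a := by
  have hrun₁ := Exec.setFld (e := e) (φ := φ) hm (scratch 3)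
    (FldExpr.elem (mod (cell 10) radixExpr))
  have hval : (FldExpr.elem (mod (cell 10) radixExpr)).val e ⟨m, φ⟩ =
      e (m 10 % (2 * (D * (n * r ^ 2 * (n * r ^ 2))))) := by
    simp [FldExpr.val, NatExpr.val, h.val_radix]
  rw [h.val_scratch, hval] at hrun₁
  obtain ⟨φ₂, hrun₂, hφ₂, hf₂⟩ := exec_stepProgram (e := e) hm h h6 h7 h8 hs hS
    (Function.update φ (D * n + 3) (e (m 10 % (2 * (D * (n * r ^ 2 * (n * r ^ 2)))))))
  obtain ⟨φ₃, hrun₃, hφ₃, hf₃⟩ := exec_copyProgram (e := e) hm h h6 hs φ₂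
  have hrun₄ := Exec.setNat (e := e) (φ := φ₃) hm (const 9) (mul (const 2) (cell 9))
  have hm₁ := hm.update 9 h9
  have hp₁ := h.update (c := 9) (by norm_num) (2 * m 9)
  have hrun₅ := Exec.setNat (e := e) (φ := φ₃) hm₁ (const 10) (div (cell 10) radixExpr)
  have hm₂ := hm₁.update 10 (v := m 10 / (2 * (D * (n * r ^ 2 * (n * r ^ 2)))))
    ((Nat.size_le_size (Nat.div_le_self _ _)).trans (hm 10))
  have hrun₆ := Exec.setNat (e := e) (φ := φ₃) hm₂ (const 11) (div (cell 11) (const 2))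
  simp only [NatExpr.val, hp₁.val_radix] at hrun₄ hrun₅ hrun₆
  rw [Function.update_of_ne (by norm_num)] at hrun₅
  rw [Function.update_of_ne (a := 11) (by norm_num), Function.update_of_ne (a := 11) (by norm_num)]
    at hrun₆
  refine ⟨φ₃, hrun₁.seq (hrun₂.seq (hrun₃.seq (hrun₄.seq (hrun₅.seq hrun₆)))), fun x hx => ?_,
    fun a ha => ?_⟩
  · rw [hφ₃ x hx, hφ₂ x hx, Function.update_self, Function.update_of_ne (by omega)]
    refine Finset.sum_congr rfl fun t _ => ?_
    rw [Function.update_of_ne (by omega)]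
  · rw [hf₃ a ha, hf₂ a ha, Function.update_of_ne (by omega)]

/-- The level loop realises the recursion `blockPoint` for one fixed coordinate. Cells 9 to 11 are
cleared at the end, so the enclosing loops find the memory m again. -/
theorem exec_coordProgram (hm : BitBounded β m) (h : ParamCells m D n r k)
    (hz : ∀ c, 6 ≤ c → m c = 0) (hpos : 0 < n * r ^ 2)
    (hS : n * r ^ 2 * (n * r ^ 2) ≤ β) (hD : 0 < D) (hL : Nat.clog 2 D + 2 ≤ β) (φ : ℕ → F) :
    ∃ φ', Exec e β coordProgram m φ m φ' ∧
      φ' (n * m 4 + m 5) = seedPoint D n r e (φ (D * n)) (fun l =>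
        e (k / (2 * (D * (n * r ^ 2 * (n * r ^ 2)))) ^ l % (2 * (D * (n * r ^ 2 * (n * r ^ 2))))))
        (m 4) (m 5) ∧
      ∀ a ≤ D * n, a ≠ n * m 4 + m 5 → φ' a = φ a := by
  have hs : n * r ^ 2 ≤ β := (Nat.le_mul_of_pos_left _ hpos).trans hS
  set B := 2 * (D * (n * r ^ 2 * (n * r ^ 2))) with hB
  set α : ℕ → F := fun l => e (k / B ^ l % B) with hα
  let M : ℕ → ℕ → ℕ := fun l => Function.update (Function.update (Function.update m 9 (2 ^ l)) 10
    (k / B ^ l)) 11 (m 4 / 2 ^ l)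
  have hMp : ∀ l, ParamCells (M l) D n r k := fun l =>
    ((h.update (by norm_num) _).update (by norm_num) _).update (by norm_num) _
  have hMm : ∀ l ≤ Nat.clog 2 D + 1, BitBounded β (M l) := fun l hl =>
    ((hm.update 9 (by rw [Nat.size_pow]; omega)).update 10
      ((Nat.size_le_size (Nat.div_le_self _ _)).trans (h.three ▸ hm 3))).update 11
      ((Nat.size_le_size (Nat.div_le_self _ _)).trans (hm 4))
  have hMne : ∀ l c, c ≠ 9 → c ≠ 10 → c ≠ 11 → M l c = m c := fun l c h9 h10 h11 => by
    simp [M, h9, h10, h11]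
  have hM9 : ∀ l, M l 9 = 2 ^ l := fun l => by simp [M]
  have hM10 : ∀ l, M l 10 = k / B ^ l := fun l => by simp [M]
  have hM11 : ∀ l, M l 11 = m 4 / 2 ^ l := fun l => by simp [M]
  have hMsucc : ∀ l, Function.update (Function.update (Function.update (M l) 9 (2 * M l 9)) 10
      (M l 10 / B)) 11 (M l 11 / 2) = M (l + 1) := by
    intro l
    rw [hM9, hM10, hM11, Nat.div_div_eq_div_mul, Nat.div_div_eq_div_mul, ← pow_succ, ← pow_succ,
      ← pow_succ']
    funext c
    simp only [M, Function.update_apply]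
    split_ifs <;> rfl
  obtain ⟨φ₁, hrun₁, hφ₁, hf₁⟩ := exec_initProgram (e := e) hm h (hz 6 le_rfl) hs φ
  have hrun₂ := Exec.setNat (e := e) (φ := φ₁) hm (const 9) (const 1)
  have hm₂ := hm.update 9 (v := 1) (by simp; omega)
  have hrun₃ := Exec.setNat (e := e) (φ := φ₁) hm₂ (const 10) (cell 3)
  have hm₃ := hm₂.update 10 (v := k) (h.three ▸ hm 3)
  have hrun₄ := Exec.setNat (e := e) (φ := φ₁) hm₃ (const 11) (cell 4)
  simp only [NatExpr.val] at hrun₂ hrun₃ hrun₄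
  rw [Function.update_of_ne (by norm_num), h.three] at hrun₃
  rw [Function.update_of_ne (a := 4) (by norm_num), Function.update_of_ne (a := 4) (by norm_num)]
    at hrun₄
  have hM0 : Function.update (Function.update (Function.update m 9 1) 10 k) 11 (m 4) = M 0 := by
    simp [M]
  rw [hM0] at hrun₄
  obtain ⟨φ₅, hrun₅, hφ₅, hf₅⟩ := Exec.loop (e := e)
    (b := Test.natLt (cell 9) (mul (const 2) (cell 0))) (P := levelProgram)
    (Nat.clog 2 D + 1) (by omega) M hMm
    (fun l ψ => (∀ x < n * r ^ 2, ψ (D * n + 4 + 2 * x) =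
      blockPoint e (n * r ^ 2) (φ (D * n)) α l (m 4) x (m 5)) ∧ ∀ a ≤ D * n, ψ a = φ a)
    -- The guard 2^l < 2D holds exactly for l ≤ `Nat.clog 2 D`, which gives `Nat.clog 2 D + 1`
    -- rounds.
    (fun l hl ψ => by
      simp only [Test.Holds, NatExpr.val, hM9, (hMp l).zero]
      rcases l with _ | l
      · omega
      · have := Nat.pow_lt_of_lt_clog (b := 2) (x := D) (y := l) (by omega)
        rw [pow_succ]
        omega)
    (fun ψ => by
      simp only [Test.Holds, NatExpr.val, hM9, (hMp _).zero]
      have := Nat.le_pow_clog one_lt_two D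
      rw [pow_succ]
      omega)
    (fun l hl ψ hψ => by
      obtain ⟨ψ', hrun', hψ', hf'⟩ := exec_levelProgram (e := e) (hMm l hl.le) (hMp l)
        (by rw [hMne l 6 (by norm_num) (by norm_num) (by norm_num), hz 6 (by norm_num)])
        (by rw [hMne l 7 (by norm_num) (by norm_num) (by norm_num), hz 7 (by norm_num)])
        (by rw [hMne l 8 (by norm_num) (by norm_num) (by norm_num), hz 8 (by norm_num)])
        hs hS (by rw [hM9, ← pow_succ', Nat.size_pow]; omega) ψ
      rw [← hB, hMsucc] at hrun'
      refine ⟨ψ', hrun', fun x hx => ?_, fun a ha => (hf' a ha).trans (hψ.2 a ha)⟩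
      rw [hψ' x hx, blockPoint]
      refine Finset.sum_congr rfl fun t ht => ?_
      rw [hM10, hM11, ← hB, hψ.2 _ le_rfl, childIndex, hψ.1]
      · rfl
      · split_ifs
        · exact Nat.div_lt_of_lt_mul (Finset.mem_range.1 ht)
        · exact Nat.mod_lt _ hpos)
    φ₁ ⟨fun x hx => by rw [hφ₁ x hx]; rfl, hf₁⟩
  have hml := hMm _ le_rfl
  have hrun₆ := Exec.setFld (e := e) (φ := φ₅) hml (add (mul (cell 1) (cell 4)) (cell 5))
    (FldExpr.read (scratch 4))
  simp only [NatExpr.val, FldExpr.val, (hMp _).val_scratch, (hMp _).one] at hrun₆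
  rw [hMne _ 4 (by norm_num) (by norm_num) (by norm_num),
    hMne _ 5 (by norm_num) (by norm_num) (by norm_num)] at hrun₆
  set φ₆ := Function.update φ₅ (n * m 4 + m 5) (φ₅ (D * n + 4)) with hφ₆
  have hrun₇ := Exec.setNat (e := e) (φ := φ₆) hml (const 9) (const 0)
  have hm₇ := hml.update 9 (v := 0) (by simp)
  have hrun₈ := Exec.setNat (e := e) (φ := φ₆) hm₇ (const 10) (const 0)
  have hm₈ := hm₇.update 10 (v := 0) (by simp)
  have hrun₉ := Exec.setNat (e := e) (φ := φ₆) hm₈ (const 11) (const 0)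
  simp only [NatExpr.val] at hrun₇ hrun₈ hrun₉
  have hM₉ : Function.update (Function.update (Function.update (M (Nat.clog 2 D + 1)) 9 0) 10 0)
      11 0 = m := by
    funext c
    simp only [M, Function.update_apply]
    split_ifs with h1 h2 h3
    · rw [h1, hz 11 (by norm_num)]
    · rw [h2, hz 10 (by norm_num)]
    · rw [h3, hz 9 (by norm_num)]
    · rfl
  rw [hM₉] at hrun₉
  refine ⟨φ₆, hrun₁.seq (hrun₂.seq (hrun₃.seq (hrun₄.seq (hrun₅.seq (hrun₆.seq (hrun₇.seq
    (hrun₈.seq hrun₉))))))), ?_, fun a ha hne => ?_⟩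
  · rw [hφ₆, Function.update_self]
    exact hφ₅ 0 hpos
  · rw [hφ₆, Function.update_of_ne hne, hf₅ a ha]

end LevelSpec

/-! ### The search for an element of large order. -/

section OrderSpec

variable {F : Type*} [Field F]

open Classical in
/-- The last one among the first elements of a sequence that has large order. -/
def lastLargeOrder (e : ℕ → F) (K : ℕ) : ℕ → F
  | 0 => 0
  | a + 1 => if HasLargeOrder K (e a) then e a else lastLargeOrder e K a

theorem hasLargeOrder_lastLargeOrder (e : ℕ → F) (K N : ℕ) (h : ∃ a < N, HasLargeOrder K (e a)) :
    HasLargeOrder K (lastLargeOrder e K N) := by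
  induction N with
  | zero =>
    obtain ⟨a, ha, _⟩ := h
    omega
  | succ N ih =>
    rw [lastLargeOrder]
    split_ifs with hN
    · exact hN
    · obtain ⟨a, ha, hgood⟩ := h
      refine ih ⟨a, ?_, hgood⟩
      rcases Nat.lt_succ_iff_lt_or_eq.1 ha with ha | rfl
      · exact ha
      · exact (hN hgood).elim

variable {e : ℕ → F} {β D n r k : ℕ} {m : ℕ → ℕ}

theorem exec_orderProgram (hm : BitBounded β m) (h : ParamCells m D n r k) (h4 : m 4 = 0)
    (h5 : m 5 = 0) (hβ : D * (n * r ^ 2 * (n * r ^ 2)) * (D * (n * r ^ 2 * (n * r ^ 2))) + 1 ≤ β)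
    (φ : ℕ → F) (hφ : φ (D * n) = 0) :
    ∃ φ', Exec e β orderProgram m φ m φ' ∧ φ' (D * n) = lastLargeOrder e
      (D * (n * r ^ 2 * (n * r ^ 2)))
      (D * (n * r ^ 2 * (n * r ^ 2)) * (D * (n * r ^ 2 * (n * r ^ 2))) + 1) := by
  set K := D * (n * r ^ 2 * (n * r ^ 2)) with hK
  have hKβ : K - 1 ≤ β := by nlinarith [Nat.sub_le K 1]
  refine Exec.forLoop (e := e) _ hβ hm h4
    (fun i => by simp [NatExpr.val, (h.update (c := 4) (by norm_num) i).val_order, hK])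
    (fun a ψ => ψ (D * n) = lastLargeOrder e K a)
    (fun a _ ψ hψ hma => ?_) φ (by rw [hφ, lastLargeOrder])
  have ha := h.update (c := 4) (by norm_num) a
  have hcell : ∀ j, (cell 4).val (Function.update (Function.update m 4 a) 5 j) = a := fun j => by
    simp [NatExpr.val]
  have hcell' : (cell 4).val (Function.update m 4 a) = a := by simp [NatExpr.val]
  by_cases h0 : e a = 0
  · refine ⟨ψ, Exec.branch hma (fun _ => Exec.skip) (fun hne => (hne ?_).elim), ?_⟩
    · simpa [Test.Holds, FldExpr.val, NatExpr.val] using h0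
    · rw [lastLargeOrder, if_neg fun hgood => hgood.1 h0, hψ]
  · have hrun₁ := Exec.setFld (e := e) (φ := ψ) hma (scratch 1) FldExpr.one
    have hrun₂ := Exec.setFld (e := e) (φ := Function.update ψ (D * n + 1) 1) hma (scratch 2)
      FldExpr.one
    rw [ha.val_scratch] at hrun₁ hrun₂
    -- Cell 1 runs through the powers of e a; cell 2 is a flag that is cleared once a positive power
    -- equals 1. After K - 1 rounds it has tested the exponents 1, …, K - 1.
    obtain ⟨ψ', hrun', hψ'0, -, hψ'2⟩ := Exec.forLoop (e := e) (c := 5)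
      (b := sub orderExpr (const 1))
      (P := seq (setFld (scratch 1) (FldExpr.mul (FldExpr.read (scratch 1))
            (FldExpr.elem (cell 4)))) <|
          branch (Test.fldEq (FldExpr.read (scratch 1)) FldExpr.one)
            (setFld (scratch 2) FldExpr.zero) skip) (K - 1) hKβ hma (by simpa using h5)
      (fun i => by simp [NatExpr.val, (ha.update (c := 5) (by norm_num) i).val_order, hK])
      (fun j χ => χ (D * n) = ψ (D * n) ∧ χ (D * n + 1) = e a ^ j ∧
        (χ (D * n + 2) = 1 ↔ ∀ i, 0 < i → i < j + 1 → e a ^ i ≠ 1))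
      (fun j _ χ hχ hmj => by
        obtain ⟨hχ0, hχ1, hχ2⟩ := hχ
        have hj := ha.update (c := 5) (by norm_num) j
        have hrun := Exec.setFld (e := e) (φ := χ) hmj (scratch 1)
          (FldExpr.mul (FldExpr.read (scratch 1)) (FldExpr.elem (cell 4)))
        simp only [FldExpr.val, hj.val_scratch, hcell, hχ1, ← pow_succ] at hrun
        by_cases h1 : e a ^ (j + 1) = 1
        · refine ⟨_, hrun.seq (Exec.branch hmj (fun _ => Exec.setFld hmj _ _)
            fun hne => (hne ?_).elim), ?_, ?_, ?_⟩
          · simp [Test.Holds, FldExpr.val, hj.val_scratch, h1]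
          · simp [hj.val_scratch, hχ0]
          · simp [hj.val_scratch]
          · simp only [hj.val_scratch, Function.update_self, FldExpr.val, zero_ne_one, false_iff]
            exact fun hall => hall (j + 1) (Nat.succ_pos j) (Nat.lt_succ_self _) h1
        · refine ⟨_, hrun.seq (Exec.branch hmj (fun hne => (h1 ?_).elim) fun _ => Exec.skip),
            ?_, ?_, ?_⟩
          · simpa [Test.Holds, FldExpr.val, hj.val_scratch] using hne
          · simp [hχ0]
          · simp
          · rw [Function.update_of_ne (by omega), hχ2]
            refine ⟨fun hall i hi hij => ?_, fun hall i hi hij => hall i hi (by omega)⟩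
            rcases Nat.lt_succ_iff_lt_or_eq.1 hij with hij | rfl
            · exact hall i hi hij
            · exact h1)
      (Function.update (Function.update ψ (D * n + 1) 1) (D * n + 2) 1)
      ⟨by simp, by simp, by simp; omega⟩
    have hgood : HasLargeOrder K (e a) ↔ ψ' (D * n + 2) = 1 := by
      rw [hψ'2, HasLargeOrder]
      refine ⟨fun hg i hi hiK => hg.2 i hi (by omega), fun hall => ⟨h0, fun i hi hiK =>
        hall i hi (by omega)⟩⟩
    have hne : ¬ (Test.fldEq (FldExpr.elem (cell 4)) FldExpr.zero).Holds e
        ⟨Function.update m 4 a, ψ⟩ := by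
      simpa [Test.Holds, FldExpr.val, NatExpr.val] using h0
    rw [lastLargeOrder]
    have hholds : (Test.fldEq (FldExpr.read (scratch 2)) FldExpr.one).Holds e
        ⟨Function.update m 4 a, ψ'⟩ ↔ HasLargeOrder K (e a) := by
      rw [hgood]
      simp [Test.Holds, FldExpr.val, ha.val_scratch]
    by_cases hg : HasLargeOrder K (e a)
    · refine ⟨_, Exec.branch hma (fun hh => (hne hh).elim) fun _ =>
        hrun₁.seq (hrun₂.seq (hrun'.seq (Exec.branch hma (fun _ => Exec.setFld hma _ _)
          fun hh => (hh (hholds.2 hg)).elim))), ?_⟩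
      rw [if_pos hg, ha.val_scratch, add_zero, Function.update_self, FldExpr.val]
      exact congrArg e hcell'
    · refine ⟨_, Exec.branch hma (fun hh => (hne hh).elim) fun _ =>
        hrun₁.seq (hrun₂.seq (hrun'.seq (Exec.branch hma (fun hh => (hg (hholds.1 hh)).elim)
          fun _ => Exec.skip))), ?_⟩
      rw [if_neg hg, hψ'0, hψ]

end OrderSpec

/-! ### Time bound, seeds as digits, and assembly. -/

/-- A bound for the bit lengths and the numbers of iterations in the main program. -/
def bitBound {R : Type*} [CommSemiring R] (D n r : R) : R :=
  2 * (D * (n * r ^ 2 * (n * r ^ 2))) * (D + 1) +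
    D * (n * r ^ 2 * (n * r ^ 2)) * (D * (n * r ^ 2 * (n * r ^ 2))) + D + 2

/-- The running time of the main program, as a polynomial in `D`, `n`, `r`. -/
def timePoly : MvPolynomial (Fin 3) ℕ :=
  MvPolynomial.C hittingProgram.weight *
    (bitBound (MvPolynomial.X 0) (MvPolynomial.X 1) (MvPolynomial.X 2) + 1) ^ hittingProgram.rank

theorem eval_timePoly (D n r : ℕ) : MvPolynomial.eval ![D, n, r] timePoly =
    hittingProgram.weight * (bitBound D n r + 1) ^ hittingProgram.rank := by
  simp [timePoly, bitBound]

theorem exists_lt_pow_digits (B : ℕ) (N : ℕ) (a : ℕ → ℕ) (ha : ∀ l, a l < B) :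
    ∃ k < B ^ N, ∀ l < N, k / B ^ l % B = a l := by
  induction N generalizing a with
  | zero => exact ⟨0, by simp, fun l hl => (Nat.not_lt_zero l hl).elim⟩
  | succ N ih =>
    obtain ⟨k, hk, hdig⟩ := ih (fun l => a (l + 1)) fun l => ha (l + 1)
    have hB : 0 < B := (Nat.zero_le _).trans_lt (ha 0)
    refine ⟨a 0 + B * k, ?_, fun l hl => ?_⟩
    · rw [pow_succ']
      calc a 0 + B * k < B + B * k := Nat.add_lt_add_right (ha 0) _
        _ = B * (k + 1) := by ring
        _ ≤ B * B ^ N := Nat.mul_le_mul_left _ hk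
    · rcases l with _ | l
      · simp [Nat.mod_eq_of_lt (ha 0)]
      · rw [pow_succ', ← Nat.div_div_eq_div_mul, Nat.add_mul_div_left _ _ hB,
          Nat.div_eq_of_lt (ha 0), zero_add, hdig l (by omega)]

theorem eq_of_mul_add_eq {n i j i' j' : ℕ} (hj : j < n) (hj' : j' < n)
    (h : n * i + j = n * i' + j') : i = i' ∧ j = j' := by
  have h1 := congrArg (· % n) h
  have h2 := congrArg (· / n) h
  simp only [Nat.mul_add_mod, Nat.mod_eq_of_lt hj, Nat.mod_eq_of_lt hj'] at h1
  simp only [Nat.mul_add_div (by omega : n > 0), Nat.div_eq_of_lt hj, Nat.div_eq_of_lt hj',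
    add_zero] at h2
  exact ⟨h2, h1⟩

section Main

variable {F : Type*} [Field F] {e : ℕ → F} {β D n r k : ℕ} {m : ℕ → ℕ}

/-- The invariant keeps g in cell D n and all coordinates written so far; distinct pairs (i, j) have
distinct addresses below D n, so nothing is overwritten. -/
theorem exec_hittingProgram (hm : BitBounded β m) (h : ParamCells m D n r k)
    (hz : ∀ c, 4 ≤ c → m c = 0) (hD : 0 < D) (hpos : 0 < n * r ^ 2) (hn : n ≤ β) (hDβ : D ≤ β)
    (hS : n * r ^ 2 * (n * r ^ 2) ≤ β) (hL : Nat.clog 2 D + 2 ≤ β)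
    (hβ : D * (n * r ^ 2 * (n * r ^ 2)) * (D * (n * r ^ 2 * (n * r ^ 2))) + 1 ≤ β)
    (φ : ℕ → F) (hφ : φ (D * n) = 0) :
    ∃ φ', Exec e β hittingProgram m φ m φ' ∧ ∀ i < D, ∀ j < n, φ' (n * i + j) =
      seedPoint D n r e (lastLargeOrder e (D * (n * r ^ 2 * (n * r ^ 2)))
        (D * (n * r ^ 2 * (n * r ^ 2)) * (D * (n * r ^ 2 * (n * r ^ 2))) + 1)) (fun l =>
        e (k / (2 * (D * (n * r ^ 2 * (n * r ^ 2)))) ^ l % (2 * (D * (n * r ^ 2 * (n * r ^ 2))))))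
        i j := by
  obtain ⟨φ₁, hrun₁, hφ₁⟩ := exec_orderProgram (e := e) hm h (hz 4 le_rfl) (hz 5 (by norm_num)) hβ
    φ hφ
  rw [← hφ₁]
  set x := seedPoint D n r e (φ₁ (D * n)) (fun l =>
    e (k / (2 * (D * (n * r ^ 2 * (n * r ^ 2)))) ^ l % (2 * (D * (n * r ^ 2 * (n * r ^ 2))))))
    with hx
  obtain ⟨φ₂, hrun₂, -, hφ₂⟩ := Exec.forLoop (e := e) (c := 4) (b := cell 0)
    (P := forLoop 5 (cell 1) coordProgram) D hDβ hm (hz 4 le_rfl)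
    (fun i => by simp [NatExpr.val, h.zero])
    (fun i ψ => ψ (D * n) = φ₁ (D * n) ∧ ∀ i' < i, ∀ j < n, ψ (n * i' + j) = x i' j)
    (fun i hi ψ hψ hmi => by
      have hpi := h.update (c := 4) (by norm_num) i
      obtain ⟨ψ', hrun', hψ'⟩ := Exec.forLoop (e := e) (c := 5) (b := cell 1)
        (P := coordProgram) n hn hmi (by simpa using hz 5 (by norm_num))
        (fun j => by simp [NatExpr.val, h.one])
        (fun j ψ => ψ (D * n) = φ₁ (D * n) ∧ (∀ i' < i, ∀ j' < n, ψ (n * i' + j') = x i' j') ∧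
          ∀ j' < j, ψ (n * i + j') = x i j')
        (fun j hj χ hχ hmj => by
          obtain ⟨hχ0, hχi, hχj⟩ := hχ
          obtain ⟨χ', hrun, hχ', hframe⟩ := exec_coordProgram (e := e) hmj
            (hpi.update (c := 5) (by norm_num) j)
            (fun c hc => by
              rw [Function.update_of_ne (by omega), Function.update_of_ne (by omega),
                hz c (by omega)]) hpos hS hD hL χ
          have h4 : Function.update (Function.update m 4 i) 5 j 4 = i := by simp
          have h5 : Function.update (Function.update m 4 i) 5 j 5 = j := by simp
          rw [h4, h5] at hχ' hframe
          have hin : ∀ i' < D, ∀ j' < n, n * i' + j' < D * n := fun i' hi' j' hj' => by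
            calc n * i' + j' < n * i' + n := Nat.add_lt_add_left hj' _
              _ = (i' + 1) * n := by ring
              _ ≤ D * n := Nat.mul_le_mul_right _ hi'
          refine ⟨χ', hrun, ?_, fun i' hi' j' hj' => ?_, fun j' hj' => ?_⟩
          · rw [hframe _ le_rfl (hin i hi j hj).ne', hχ0]
          · rw [hframe _ (hin i' (hi'.trans hi) j' hj').le, hχi i' hi' j' hj']
            exact fun heq => hi'.ne (eq_of_mul_add_eq hj' hj heq).1
          · rcases Nat.lt_succ_iff_lt_or_eq.1 hj' with hj' | rfl
            · rw [hframe _ (hin i hi j' (hj'.trans hj)).le (by omega), hχj j' hj']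
            · rw [hχ', hχ0])
        ψ ⟨hψ.1, hψ.2, fun j' hj' => (Nat.not_lt_zero _ hj').elim⟩
      refine ⟨ψ', hrun', hψ'.1, fun i' hi' j hj => ?_⟩
      rcases Nat.lt_succ_iff_lt_or_eq.1 hi' with hi' | rfl
      · exact hψ'.2.1 i' hi' j hj
      · exact hψ'.2.2 j hj)
    φ₁ ⟨rfl, fun i' hi' => (Nat.not_lt_zero _ hi').elim⟩
  exact ⟨φ₂, hrun₁.seq hrun₂, hφ₂⟩

/-- The point of the hitting set with index `k`. -/
def hittingPoint (e : ℕ → F) (D n r k : ℕ) (i j : ℕ) : F :=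
  seedPoint D n r e (lastLargeOrder e (D * (n * r ^ 2 * (n * r ^ 2)))
    (D * (n * r ^ 2 * (n * r ^ 2)) * (D * (n * r ^ 2 * (n * r ^ 2))) + 1)) (fun l =>
    e (k / (2 * (D * (n * r ^ 2 * (n * r ^ 2)))) ^ l % (2 * (D * (n * r ^ 2 * (n * r ^ 2)))))) i j

theorem computesPoint_hittingPoint (hD : 1 ≤ D) (hn : 1 ≤ n) (hr : 1 ≤ r)
    (hk : k < (2 * (D * (n * r ^ 2 * (n * r ^ 2)))) ^ (Nat.clog 2 D + 1)) :
    ComputesPoint e hittingProgram D n r k (fun p => hittingPoint e D n r k p.1 p.2)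
      (MvPolynomial.eval ![D, n, r] timePoly) := by
  have hpos : 0 < n * r ^ 2 := Nat.mul_pos hn (pow_pos hr 2)
  have hns : n ≤ n * r ^ 2 := Nat.le_mul_of_pos_right n (pow_pos hr 2)
  have hrs : r ≤ n * r ^ 2 := (Nat.le_self_pow two_ne_zero r).trans (Nat.le_mul_of_pos_left _ hn)
  have hSs : n * r ^ 2 ≤ n * r ^ 2 * (n * r ^ 2) := Nat.le_mul_of_pos_left _ hpos
  have hKS : n * r ^ 2 * (n * r ^ 2) ≤ D * (n * r ^ 2 * (n * r ^ 2)) :=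
    Nat.le_mul_of_pos_left _ hD
  have hclog : Nat.clog 2 D ≤ D := Nat.clog_le_of_le_pow D.lt_two_pow_self.le
  have hβ : bitBound D n r = 2 * (D * (n * r ^ 2 * (n * r ^ 2))) * (D + 1) +
    D * (n * r ^ 2 * (n * r ^ 2)) * (D * (n * r ^ 2 * (n * r ^ 2))) + D + 2 := rfl
  have hKβ : 2 * (D * (n * r ^ 2 * (n * r ^ 2))) ≤
      2 * (D * (n * r ^ 2 * (n * r ^ 2))) * (D + 1) := Nat.le_mul_of_pos_right _ D.succ_pos
  -- The index is quasipolynomially large, but its bit length is polynomial: B ≤ 2^B and `Nat.clog 2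
  -- D` ≤ D give k < 2^(B (D + 1)).
  have hksize : k.size ≤ 2 * (D * (n * r ^ 2 * (n * r ^ 2))) * (D + 1) := by
    refine Nat.size_le.2 (hk.trans_le ?_)
    rw [pow_mul]
    exact (Nat.pow_le_pow_left Nat.lt_two_pow_self.le _).trans
      (Nat.pow_le_pow_right Nat.one_le_two_pow (by omega))
  have hparam : ParamCells (inputMemory F D n r k).nat D n r k := ⟨rfl, rfl, rfl, rfl⟩
  have hzero : ∀ c, 4 ≤ c → (inputMemory F D n r k).nat c = 0 := fun c hc =>
    List.getD_eq_default _ _ hc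
  have hbit : BitBounded (bitBound D n r) (inputMemory F D n r k).nat := by
    intro c
    rcases lt_or_ge c 4 with hc | hc
    · interval_cases c
      · rw [hparam.zero]
        exact (size_le_self D).trans (by omega)
      · rw [hparam.one]
        exact (size_le_self n).trans (by omega)
      · rw [hparam.two]
        exact (size_le_self r).trans (by omega)
      · rw [hparam.three]
        omega
    · rw [hzero c hc]
      simp
  obtain ⟨φ', ⟨t, ht, hrun⟩, hφ'⟩ := exec_hittingProgram (e := e) hbit hparam hzero hD hpos
    (by omega) (by omega) (by omega) (by omega) (by omega) (inputMemory F D n r k).fld rfl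
  refine ⟨_, t, hrun, ?_, fun i j => hφ' i i.2 j j.2⟩
  rwa [eval_timePoly]

theorem isHittingSet_hittingPoint (he : IsFieldEnumeration e) (hD : 1 ≤ D) (hn : 1 ≤ n)
    (hr : 1 ≤ r) (hF : (((2 * D * n * r ^ 3) ^ 2 : ℕ) : Cardinal) ≤ Cardinal.mk F) :
    IsHittingSet (setMultilinearABPClass F D n r) (Set.range
      fun (k : Fin ((2 * (D * (n * r ^ 2 * (n * r ^ 2)))) ^ (Nat.clog 2 D + 1)))
        (p : Fin D × Fin n) => hittingPoint e D n r k p.1 p.2) := by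
  have hK : 1 ≤ D * (n * r ^ 2 * (n * r ^ 2)) := Nat.succ_le_of_lt (by positivity)
  have hq : 2 * (D * (n * r ^ 2 * (n * r ^ 2))) ≤ (2 * D * n * r ^ 3) ^ 2 := by
    have h1 : (2 * D * n * r ^ 3) ^ 2 =
        2 * (D * (n * r ^ 2 * (n * r ^ 2))) * (2 * D * r ^ 2) := by ring
    rw [h1]
    exact Nat.le_mul_of_pos_right _ (by positivity)
  have hinj := he.injOn (B := 2 * (D * (n * r ^ 2 * (n * r ^ 2))))
    ((Nat.cast_le.2 hq).trans hF)
  -- With K = D s² ≥ 1, the search needs K + 1 ≤ |F|, which follows from K + 1 ≤ 2K = B ≤ |F|.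
  have hgood := hasLargeOrder_lastLargeOrder e (D * (n * r ^ 2 * (n * r ^ 2))) _
    (he.exists_hasLargeOrder hK ((Nat.cast_le.2 (by omega)).trans hF))
  intro f hf
  refine ⟨fun h x _ => by rw [h, map_zero], fun hvan => ?_⟩
  by_contra hf0
  obtain ⟨a, ha, hne⟩ := exists_seedPoint_ne_zero hD hn hr e _ _ (by omega) hinj hgood.injOn hf hf0
  obtain ⟨k, hk, hdig⟩ := exists_lt_pow_digits _ (Nat.clog 2 D + 1) a ha
  refine hne ?_
  rw [← hvan _ ⟨⟨k, hk⟩, rfl⟩]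
  congr 2
  funext p
  -- Only the first `Nat.clog 2 D + 1` seeds matter, and these are the digits of k.
  exact blockPoint_congr e (n * r ^ 2) _ (α := fun l => e (a l))
    (β := fun l => e (k / (2 * (D * (n * r ^ 2 * (n * r ^ 2)))) ^ l %
      (2 * (D * (n * r ^ 2 * (n * r ^ 2)))))) (fun l hl => congrArg e (hdig l hl).symm) p.1 0 p.2

theorem setMultilinearABPClass_subset_zero (hD : 1 ≤ D) (h : n = 0 ∨ r = 0)
    {f : MvPolynomial (Fin D × Fin n) F} (hf : f ∈ setMultilinearABPClass F D n r) : f = 0 := by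
  obtain ⟨A, hA, rfl⟩ := hf
  rcases h with rfl | rfl
  · refine Finset.sum_eq_zero fun p _ => Finset.prod_eq_zero (Finset.mem_univ ⟨0, hD⟩) ?_
    simp [SetMultilinearABP.linearForm]
  · have h1 : A.size 0 ≤ A.width := Finset.le_sup (Finset.mem_univ 0)
    have h2 := A.size_zero
    omega

end Main

end PIT

end

theorem mainTheorem3 :
    ∃ (P : PIT.Program) (p : MvPolynomial (Fin 3) ℕ),
      ∀ (F : Type*) [Field F] (e : ℕ → F), PIT.IsFieldEnumeration e →
        ∀ D n r : ℕ, 1 ≤ D → (((2 * D * n * r ^ 3) ^ 2 : ℕ) : Cardinal) ≤ Cardinal.mk F →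
          ∃ N : ℕ, N ≤ (2 * D * n ^ 2 * r ^ 4) ^ (Nat.clog 2 D + 1) ∧
            ∃ h : Fin N → (Fin D × Fin n → F),
              PIT.IsHittingSet (PIT.setMultilinearABPClass F D n r) (Set.range h) ∧
              ∀ k : Fin N,
                PIT.ComputesPoint e P D n r k (h k) (MvPolynomial.eval ![D, n, r] p) := by
  refine ⟨PIT.hittingProgram, PIT.timePoly, fun F _ e he D n r hD hF => ?_⟩
  by_cases h : n = 0 ∨ r = 0
  -- The size bound is 0 here, which forces the empty set; it hits a class without nonzero members.
  · refine ⟨0, Nat.zero_le _, Fin.elim0, fun f hf => ?_, fun k => k.elim0⟩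
    simp [PIT.setMultilinearABPClass_subset_zero hD h hf]
  · have hn : 1 ≤ n := by omega
    have hr : 1 ≤ r := by omega
    refine ⟨(2 * (D * (n * r ^ 2 * (n * r ^ 2)))) ^ (Nat.clog 2 D + 1), le_of_eq ?_,
      fun k p => PIT.hittingPoint e D n r k p.1 p.2,
      PIT.isHittingSet_hittingPoint he hD hn hr hF,
      fun k => PIT.computesPoint_hittingPoint hD hn hr k.2⟩
    congr 1
    ring
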